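/- **Setting.** A local language $L$ is a many-sorted relational first-order language with constants in which every single sort $s$ carries a distinguished partially ordered monoid $D^s$ of binary relation symbols (locality relations), whose identity is the equality symbol of $s$ and is also the least element of $D^s$, together with a function $B$ assigning to any constants $c_1,c_2$ of the same sort a locality relation $B_{c_1,c_2}$ on that sort. $|L|$ denotes the (infinite) number of $L$-formulas. All structures have nonempty sorts. A local $L$-structure is an $L$-structure in which locality relations are symmetric, $d_1\le d_2$ implies $d_1\subseteq d_2$, $d_1\circ d_2\subseteq d_1\ast d_2$, $B_{c_1,c_2}(c_1,c_2)$ holds, and any two elements of the same single sort are related by some locality relation. Positive formulas are built from atomic formulas by $\wedge,\vee,\exists$; local positive formulas are built from atomic formulas by $\wedge,\vee$ and the quantifiers $\exists x\,(d(x,t)\wedge\cdot)$, with $d$ a locality relation and $t$ a term in which $x$ does not appear. A negative local theory is a set $T$ of negations of positive sentences which contains every such sentence true in all local models of $T$. Write $T\models\psi$ if $\psi$ holds in all local models of $T$. A homomorphism is a positive embedding if it reflects all positive formulas. A local model $M$ of $T$ is local positively closed if every homomorphism from $M$ to a local model of $T$ is a positive embedding. For a cardinal $\kappa$, a local model $M$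 of $T$ is $\kappa$-ultrahomogeneous if for every positive embedding $f:A\to M$ and every homomorphism $g:A\to N$ to a local model $N$ of $T$ with $|A|,|N|<\kappa$ there is a homomorphism $h:N\to M$ with $f=h\circ g$. A retractor of $T$ is a local model $R$ of $T$ such that for every homomorphism $f:R\to N$ to a local model $N$ of $T$ there is a homomorphism $g:N\to R$ with $g\circ f=\mathrm{id}$. Two local models of $T$ are compatible if both map homomorphically to a common local model of $T$. $T$ has retractors if every local model of $T$ is compatible with some retractor of $T$. A bound of a variable $x=(x_i)_i$ is a conjunction consisting of one formula $d_i(x_i,c_i)$, with $c_i$ a constant and $d_i$ a locality relation, for each $x_i$ whose sort has constants, and of one formula $d_{i,j}(x_i,x_j)$, with $d_{i,j}$ a locality relation, for each pair $x_i,x_j$ on the same sort. $T$ is local positively compact if for any two distinct single variables $x,y$ on the same sort, any finite variable $z$ disjoint from $x,y$, any local positive formula $\varphi(x,y,z)$ with $T\models\neg\exists x,y\,(\exists z\,\varphi(x,y,z)\wedge x=y)$, any bound $\beta(x,z)$ and any locality relation $d(x,y)$, there is an integer $k>0$ such that $$T\models\neg\exists x_1,\dots,x_k,z\ \bigwedge_{i\ne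 j}\beta(x_i,z)\wedge d(x_i,x_j)\wedge\varphi(x_i,x_j,z).$$ **Theorem.** Let $T$ be a locally satisfiable negative local theory in a local language $L$, and suppose that $T$ is local positively compact. Then every $|L|^+$-ultrahomogeneous local positively closed model of $T$ is a retractor of $T$. In particular, $T$ has retractors. -/

import Mathlib

universe u

namespace LocalLogic

/-- A (many-sorted) local first-order language. Apart from constants there are no function symbols.
The binary relation symbols are split into the locality relation symbols `Dist s` on each single
sort `s` and all the remaining relation symbols `Rel`. -/
structure LocalLanguage where
  /-- single sorts -/
  Srt : Type u
  /-- constant symbols of each single sort -/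
  Const : Srt → Type u
  /-- relation symbols which are not locality relation symbols -/
  Rel : Type u
  /-- arity of a relation symbol -/
  arity : Rel → ℕ
  /-- sort (tuple of single sorts) of a relation symbol -/
  relSort : (R : Rel) → Fin (arity R) → Srt
  /-- locality relation symbols on each single sort; the symbol `1` is the equality symbol -/
  Dist : Srt → Type u
  [distMonoid : ∀ s, Monoid (Dist s)]
  [distOrder : ∀ s, PartialOrder (Dist s)]
  /-- `Dist s` is a partially ordered monoid -/
  mul_le_mul : ∀ {s : Srt} {a b c d : Dist s}, a ≤ b → c ≤ d → a * c ≤ b * d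
  /-- the identity is the least element -/
  one_le : ∀ {s : Srt} (d : Dist s), 1 ≤ d
  /-- the bound function -/
  bound : ∀ {s : Srt}, Const s → Const s → Dist s

attribute [instance] LocalLanguage.distMonoid LocalLanguage.distOrder

/-- The cardinality `|L|`, i.e. the number of formulas of `L`: the number of symbols, or `ℵ₀` if
there are finitely many. (Each single sort has its own equality symbol `1 : Dist s`, so
`|L|` is at least the number of single sorts.) -/
noncomputable def LocalLanguage.card (L : LocalLanguage.{u}) : Cardinal.{u} :=
  max Cardinal.aleph0
    (Cardinal.mk (Σ s, L.Const s) + Cardinal.mk L.Rel + Cardinal.mk (Σ s, L.Dist s))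

section Formulas

/-- Single variables: countably many of each single sort. -/
abbrev Var (L : LocalLanguage.{u}) : Type u := L.Srt × ℕ

/-- Terms of sort `s`: the variable `(s, n)` or a constant symbol. -/
inductive Term (L : LocalLanguage.{u}) (s : L.Srt) : Type u
  | var (n : ℕ) : Term L s
  | const (c : L.Const s) : Term L s

/-- First-order formulas. `dist d t₁ t₂` is the atomic formula `d(t₁, t₂)`; it is `t₁ = t₂`
when `d = 1`. `ex s n φ` quantifies the variable `(s, n)`. -/
inductive Formula (L : LocalLanguage.{u}) : Type u
  | top : Formula L
  | bot : Formula L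
  | rel (R : L.Rel) (t : ∀ i, Term L (L.relSort R i)) : Formula L
  | dist {s : L.Srt} (d : L.Dist s) (t₁ t₂ : Term L s) : Formula L
  | neg (φ : Formula L) : Formula L
  | and (φ ψ : Formula L) : Formula L
  | or (φ ψ : Formula L) : Formula L
  | ex (s : L.Srt) (n : ℕ) (φ : Formula L) : Formula L

variable {L : LocalLanguage.{u}}

/-- The formula `t₁ = t₂`. -/
def Formula.eq {s : L.Srt} (t₁ t₂ : Term L s) : Formula L := .dist 1 t₁ t₂

/-- Existential quantification over a finite tuple of variables. -/
def Formula.exs (z : List (Var L)) (φ : Formula L) : Formula L :=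
  z.foldr (fun w ψ => .ex w.1 w.2 ψ) φ

/-- Variables occurring in a term. -/
def Term.vars {s : L.Srt} : Term L s → Set (Var L)
  | .var n => {(s, n)}
  | .const _ => ∅

/-- Free variables of a formula. -/
def Formula.freeVars : Formula L → Set (Var L)
  | .top => ∅
  | .bot => ∅
  | .rel _ t => ⋃ i, (t i).vars
  | .dist _ t₁ t₂ => t₁.vars ∪ t₂.vars
  | .neg φ => φ.freeVars
  | .and φ ψ => φ.freeVars ∪ ψ.freeVars
  | .or φ ψ => φ.freeVars ∪ ψ.freeVars
  | .ex s n φ => φ.freeVars \ {(s, n)}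

def Formula.IsSentence (φ : Formula L) : Prop := φ.freeVars = ∅

/-- Positive formulas: built from atomic formulas with `∧`, `∨` and `∃`. -/
inductive Formula.IsPositive : Formula L → Prop
  | top : IsPositive .top
  | bot : IsPositive .bot
  | rel (R : L.Rel) (t : ∀ i, Term L (L.relSort R i)) : IsPositive (.rel R t)
  | dist {s : L.Srt} (d : L.Dist s) (t₁ t₂ : Term L s) : IsPositive (.dist d t₁ t₂)
  | and {φ ψ : Formula L} : IsPositive φ → IsPositive ψ → IsPositive (.and φ ψ)
  | or {φ ψ : Formula L} : IsPositive φ → IsPositive ψ → IsPositive (.or φ ψ)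
  | ex (s : L.Srt) (n : ℕ) {φ : Formula L} : IsPositive φ → IsPositive (.ex s n φ)

/-- Local positive formulas: built from atomic formulas with `∧`, `∨` and local existential
quantification `∃ x ∈ d(t), φ := ∃ x, d(x, t) ∧ φ`, where `t` is a term in which `x` does
not appear. -/
inductive Formula.IsLocalPositive : Formula L → Prop
  | top : IsLocalPositive .top
  | bot : IsLocalPositive .bot
  | rel (R : L.Rel) (t : ∀ i, Term L (L.relSort R i)) : IsLocalPositive (.rel R t)
  | dist {s : L.Srt} (d : L.Dist s) (t₁ t₂ : Term L s) : IsLocalPositive (.dist d t₁ t₂)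
  | and {φ ψ : Formula L} : IsLocalPositive φ → IsLocalPositive ψ → IsLocalPositive (.and φ ψ)
  | or {φ ψ : Formula L} : IsLocalPositive φ → IsLocalPositive ψ → IsLocalPositive (.or φ ψ)
  | locEx {s : L.Srt} (n : ℕ) (d : L.Dist s) (t : Term L s) (ht : t ≠ .var n) {φ : Formula L} :
      IsLocalPositive φ → IsLocalPositive (.ex s n (.and (.dist d (.var n) t) φ))

/-- Negative formulas: negations of positive formulas. -/
def Formula.IsNegative (φ : Formula L) : Prop := ∃ ψ : Formula L, ψ.IsPositive ∧ φ = .neg ψ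

end Formulas

/-- An `L`-structure (with nonempty sorts, and equality interpreted as equality). -/
structure Struct (L : LocalLanguage.{u}) where
  /-- the universe of each single sort -/
  carrier : L.Srt → Type u
  nonempty : ∀ s, Nonempty (carrier s)
  const : ∀ {s : L.Srt}, L.Const s → carrier s
  rel : (R : L.Rel) → (∀ i, carrier (L.relSort R i)) → Prop
  dist : ∀ {s : L.Srt}, L.Dist s → carrier s → carrier s → Prop
  dist_one : ∀ {s : L.Srt} (a b : carrier s), dist (1 : L.Dist s) a b ↔ a = b

variable {L : LocalLanguage.{u}}

namespace Struct

/-- The cardinality `|M|`: the total number of elements in all single sorts. -/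
def card (M : Struct L) : Cardinal.{u} := Cardinal.mk (Σ s, M.carrier s)

/-- Assignments of the variables in `M`. -/
abbrev Assignment (M : Struct L) : Type u := ∀ s, ℕ → M.carrier s

open Classical in
/-- The assignment which maps `(s, n)` to `a` and agrees with `v` elsewhere. -/
noncomputable def Assignment.update {M : Struct L} (v : M.Assignment) (s : L.Srt) (n : ℕ)
    (a : M.carrier s) : M.Assignment :=
  Function.update v s (Function.update (v s) n a)

/-- Value of a term. -/
def eval (M : Struct L) (v : M.Assignment) {s : L.Srt} : Term L s → M.carrier s
  | .var n => v s n
  | .const c => M.const c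

/-- Tarskian satisfaction. -/
def Sat (M : Struct L) : M.Assignment → Formula L → Prop
  | _, .top => True
  | _, .bot => False
  | v, .rel R t => M.rel R (fun i => M.eval v (t i))
  | v, .dist d t₁ t₂ => M.dist d (M.eval v t₁) (M.eval v t₂)
  | v, .neg φ => ¬ M.Sat v φ
  | v, .and φ ψ => M.Sat v φ ∧ M.Sat v ψ
  | v, .or φ ψ => M.Sat v φ ∨ M.Sat v ψ
  | v, .ex s n φ => ∃ a : M.carrier s, M.Sat (v.update s n a) φ

/-- The locality axioms. -/
structure IsLocal (M : Struct L) : Prop where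
  symm : ∀ {s : L.Srt} (d : L.Dist s) (a b : M.carrier s), M.dist d a b → M.dist d b a
  mono : ∀ {s : L.Srt} (d₁ d₂ : L.Dist s), d₁ ≤ d₂ →
    ∀ a b : M.carrier s, M.dist d₁ a b → M.dist d₂ a b
  comp : ∀ {s : L.Srt} (d₁ d₂ : L.Dist s) (a b c : M.carrier s),
    M.dist d₁ a b → M.dist d₂ b c → M.dist (d₁ * d₂) a c
  bound_const : ∀ {s : L.Srt} (c₁ c₂ : L.Const s),
    M.dist (L.bound c₁ c₂) (M.const c₁) (M.const c₂)
  exists_dist : ∀ {s : L.Srt} (a b : M.carrier s), ∃ d : L.Dist s, M.dist d a b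

/-- `M` is a local model of a set `T` of sentences. -/
def IsLocalModel (M : Struct L) (T : Set (Formula L)) : Prop :=
  M.IsLocal ∧ ∀ φ ∈ T, ∀ v : M.Assignment, M.Sat v φ

end Struct

/-- Homomorphisms of `L`-structures. -/
structure Hom (M N : Struct L) where
  toFun : ∀ s, M.carrier s → N.carrier s
  map_const : ∀ {s : L.Srt} (c : L.Const s), toFun s (M.const c) = N.const c
  map_rel : ∀ (R : L.Rel) (a : ∀ i, M.carrier (L.relSort R i)),
    M.rel R a → N.rel R (fun i => toFun _ (a i))
  map_dist : ∀ {s : L.Srt} (d : L.Dist s) (a b : M.carrier s),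
    M.dist d a b → N.dist d (toFun s a) (toFun s b)

/-- Positive embeddings: homomorphisms reflecting all positive formulas. -/
def Hom.IsPositiveEmbedding {M N : Struct L} (f : Hom M N) : Prop :=
  ∀ φ : Formula L, φ.IsPositive → ∀ v : M.Assignment,
    N.Sat (fun s n => f.toFun s (v s n)) φ → M.Sat v φ

/-- A negative local theory: a set of negative sentences closed under local implication. -/
def IsNegativeLocalTheory (T : Set (Formula L)) : Prop :=
  (∀ φ ∈ T, φ.IsNegative ∧ φ.IsSentence) ∧
  ∀ φ : Formula L, φ.IsNegative → φ.IsSentence →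
    (∀ M : Struct L, M.IsLocalModel T → ∀ v : M.Assignment, M.Sat v φ) → φ ∈ T

def IsLocallySatisfiable (T : Set (Formula L)) : Prop := ∃ M : Struct L, M.IsLocalModel T

/-- `M` is a local positively closed model of `T`. -/
def IsLocalPositivelyClosed (T : Set (Formula L)) (M : Struct L) : Prop :=
  M.IsLocalModel T ∧
  ∀ N : Struct L, N.IsLocalModel T → ∀ f : Hom M N, f.IsPositiveEmbedding

/-- `M` is a local positively `κ`-ultrahomogeneous model of `T`. -/
def IsUltrahomogeneous (κ : Cardinal.{u}) (T : Set (Formula L)) (M : Struct L) : Prop :=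
  M.IsLocalModel T ∧
  ∀ (A B : Struct L) (f : Hom A M) (g : Hom A B), f.IsPositiveEmbedding → B.IsLocalModel T →
    A.card < κ → B.card < κ →
    ∃ h : Hom B M, ∀ (s : L.Srt) (a : A.carrier s), h.toFun s (g.toFun s a) = f.toFun s a

/-- `R` is a retractor of `T`: a local model such that every homomorphism from it to a local model
has a retraction. -/
def IsRetractor (T : Set (Formula L)) (R : Struct L) : Prop :=
  R.IsLocalModel T ∧
  ∀ N : Struct L, N.IsLocalModel T → ∀ f : Hom R N,
    ∃ g : Hom N R, ∀ (s : L.Srt) (a : R.carrier s), g.toFun s (f.toFun s a) = a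

/-- Two local models are compatible in `T` if they map to a common local model of `T`. -/
def AreCompatible (T : Set (Formula L)) (A B : Struct L) : Prop :=
  ∃ M : Struct L, M.IsLocalModel T ∧ Nonempty (Hom A M) ∧ Nonempty (Hom B M)

/-- `T` has retractors: there is a retractor of `T` at every local model of `T`, i.e. every local
model of `T` is compatible with some retractor of `T`. -/
def HasRetractors (T : Set (Formula L)) : Prop :=
  ∀ M : Struct L, M.IsLocalModel T → ∃ R : Struct L, IsRetractor T R ∧ AreCompatible T M R

/-- `φ ⊥ ψ` in `T`: no local model of `T` satisfies `∃ x, φ(x) ∧ ψ(x)`. -/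
def IsDenial (T : Set (Formula L)) (φ ψ : Formula L) : Prop :=
  ∀ M : Struct L, M.IsLocalModel T → ∀ v : M.Assignment, ¬ (M.Sat v φ ∧ M.Sat v ψ)

/-- The choices determining a bound: for each variable whose sort has constants, one of these
constants and a locality relation on the sort; for each pair of variables of the same sort, a
locality relation on this sort. -/
structure Bound (L : LocalLanguage.{u}) where
  pt : ∀ s : L.Srt, Nonempty (L.Const s) → ℕ → L.Const s
  ptDist : ∀ s : L.Srt, ℕ → L.Dist s
  pairDist : ∀ s : L.Srt, ℕ → ℕ → L.Dist s

/-- The bound of the (multi)variable `X`, as a quantifier free partial type on `X`: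
all `d_i(x_i, c_i)` for `x_i ∈ X` on a sort with constants, and all `d_{i,j}(x_i, x_j)` for
`x_i, x_j ∈ X` on the same sort. -/
def Bound.formulas (B : Bound L) (X : Set (Var L)) : Set (Formula L) :=
  {φ | ∃ (s : L.Srt) (h : Nonempty (L.Const s)) (i : ℕ), (s, i) ∈ X ∧
      φ = .dist (B.ptDist s i) (.var i) (.const (B.pt s h i))} ∪
  {φ | ∃ (s : L.Srt) (i j : ℕ), (s, i) ∈ X ∧ (s, j) ∈ X ∧
      φ = .dist (B.pairDist s i j) (.var i) (.var j)}

/-- Local positive compactness. Here `x = (s, i)` and `y = (s, j)` are different single variables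
of the same sort and `z` is a finite tuple of other variables. For every local positive formula
`φ(x, y, z)` with `∃ z, φ(x, y, z) ⊥ x = y`, every bound `B(x, z)` and every locality relation
`d(x, y)`, there is `k > 0` such that in no local model of `T` there are `a_1, ..., a_k` and a value
of `z` satisfying `B(a_p, z) ∧ d(a_p, a_q) ∧ φ(a_p, a_q, z)` for all `p ≠ q`. -/
def IsLocalPositivelyCompact (T : Set (Formula L)) : Prop :=
  ∀ (s : L.Srt) (i j : ℕ) (z : List (Var L)), i ≠ j → (s, i) ∉ z → (s, j) ∉ z →
    ∀ φ : Formula L, φ.IsLocalPositive → φ.freeVars ⊆ {(s, i), (s, j)} ∪ {w | w ∈ z} →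
      IsDenial T (.exs z φ) (.eq (Term.var (s := s) i) (Term.var j)) →
    ∀ (B : Bound L) (d : L.Dist s),
    ∃ k : ℕ, 0 < k ∧ ∀ M : Struct L, M.IsLocalModel T →
      ¬ ∃ (a : Fin k → M.carrier s) (v : M.Assignment), ∀ p q : Fin k, p ≠ q →
        (∀ β ∈ B.formulas ({(s, i)} ∪ {w | w ∈ z}), M.Sat (v.update s i (a p)) β) ∧
        M.dist d (a p) (a q) ∧
        M.Sat ((v.update s i (a p)).update s j (a q)) φ

end LocalLogic

/-! Call a local model atomically closed when every homomorphism from it to a local model is an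
embedding. Local positively closed models have this property, and every local model maps to an
atomically closed one (`exists_hom_isAtomicallyClosed`). An atomically closed `R` is a retractor as
soon as all homomorphisms from `R` to atomically closed models are onto: given `R → N`, continue to
an atomically closed `K`, and compose `N → K` with the inverse of the surjective embedding `R → K`
(`IsAtomicallyClosed.isRetractor`).

Surjectivity comes from playing separation against compactness. Fix a base point in each sort. In an
atomically closed model, distinct points are separated by a local positive formula whose only
parameters are base points (`IsAtomicallyClosed.exists_separates`); otherwise a bounded part of a
reduced product would be a local model in which the two points get identified. Local positive
compactness, on the other hand, forbids an infinite sequence inside a ball on which one separating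
formula holds of all pairs `i < j` (`IsLocalPositivelyCompact.finite_of_sat`).

Suppose `R` is `|L|⁺`-ultrahomogeneous and `f : R → K` misses `b`. Choose for each `a` in `R` a
formula separating `f a` from `b`. By ultrahomogeneity and Löwenheim-Skolem one builds recursively
`|L|⁺` elements in a single ball of `R`, each behaving like `b` over the earlier ones. There are at
most `|L|` formulas, so infinitely many of these elements share one formula, which contradicts
compactness.

For the existence of retractors, the same two facts and a tree argument in the style of Erdős and
Rado bound the size of all atomically closed models. Zorn's lemma then gives, above any local model,
a maximal atomically closed model, and maximality forces its homomorphisms to atomically closed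
models to be onto. -/

namespace LocalLogic

variable {L : LocalLanguage.{u}}

/-! ### Assignments, free variables and satisfaction -/

namespace Struct.Assignment

variable {M : Struct L}

theorem update_self (v : M.Assignment) (s : L.Srt) (n : ℕ) (a : M.carrier s) :
    v.update s n a s n = a := by
  simp [update]

theorem update_of_ne (v : M.Assignment) {s t : L.Srt} {n m : ℕ} (a : M.carrier s)
    (h : (t, m) ≠ (s, n)) : v.update s n a t m = v t m := by
  unfold update
  by_cases hst : t = s
  · subst hst
    have hm : m ≠ n := fun e => h (by rw [e])
    simp [hm]
  · simp [hst]

theorem update_of_index_ne (v : M.Assignment) {s t : L.Srt} {n m : ℕ} (a : M.carrier s)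
    (h : m ≠ n) : v.update s n a t m = v t m :=
  v.update_of_ne a fun e => h (congrArg Prod.snd e)

/-- Two updated assignments agree at a variable if the original ones do, away from the updated
variable. -/
theorem update_congr {v w : M.Assignment} {s t : L.Srt} {n m : ℕ} (a : M.carrier s)
    (h : (t, m) ≠ (s, n) → v t m = w t m) : v.update s n a t m = w.update s n a t m := by
  by_cases e : (t, m) = (s, n)
  · obtain ⟨rfl, rfl⟩ := Prod.mk.inj e
    rw [update_self, update_self]
  · rw [update_of_ne _ _ e, update_of_ne _ _ e, h e]

end Struct.Assignment

theorem Formula.freeVars_finite (φ : Formula L) : φ.freeVars.Finite := by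
  have ht : ∀ {s : L.Srt} (t : Term L s), t.vars.Finite := by
    intro s t
    cases t <;> simp [Term.vars]
  induction φ with
  | top => simp [freeVars]
  | bot => simp [freeVars]
  | rel R t => exact Set.finite_iUnion fun i => ht _
  | dist d t₁ t₂ => exact (ht _).union (ht _)
  | neg φ ih => exact ih
  | and φ ψ ih₁ ih₂ => exact ih₁.union ih₂
  | or φ ψ ih₁ ih₂ => exact ih₁.union ih₂
  | ex s n φ ih => exact ih.subset Set.sdiff_subset

theorem Formula.IsLocalPositive.isPositive {φ : Formula L} (h : φ.IsLocalPositive) :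
    φ.IsPositive := by
  induction h with
  | top => exact .top
  | bot => exact .bot
  | rel R t => exact .rel R t
  | dist d t₁ t₂ => exact .dist d t₁ t₂
  | and _ _ ih₁ ih₂ => exact .and ih₁ ih₂
  | or _ _ ih₁ ih₂ => exact .or ih₁ ih₂
  | locEx n d t ht _ ih => exact .ex _ _ (.and (.dist _ _ _) ih)

namespace Struct

theorem eval_congr (M : Struct L) {v w : M.Assignment} {s : L.Srt} (t : Term L s)
    (h : ∀ s n, (s, n) ∈ t.vars → v s n = w s n) : M.eval v t = M.eval w t := by
  cases t with
  | var n => exact h _ _ rfl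
  | const c => rfl

/-- Satisfaction depends only on the values of the free variables. -/
theorem sat_congr (M : Struct L) (φ : Formula L) {v w : M.Assignment}
    (h : ∀ s n, (s, n) ∈ φ.freeVars → v s n = w s n) : M.Sat v φ ↔ M.Sat w φ := by
  induction φ generalizing v w with
  | top => exact Iff.rfl
  | bot => exact Iff.rfl
  | rel R t =>
    simp only [Sat]
    rw [funext fun i => M.eval_congr (t i) fun s n hn => h s n (Set.mem_iUnion.2 ⟨i, hn⟩)]
  | dist d t₁ t₂ =>
    simp only [Sat]
    rw [M.eval_congr t₁ fun s n hn => h s n (Or.inl hn),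
      M.eval_congr t₂ fun s n hn => h s n (Or.inr hn)]
  | neg φ ih => exact not_congr (ih h)
  | and φ ψ ih₁ ih₂ =>
    exact and_congr (ih₁ fun s n hn => h s n (Or.inl hn)) (ih₂ fun s n hn => h s n (Or.inr hn))
  | or φ ψ ih₁ ih₂ =>
    exact or_congr (ih₁ fun s n hn => h s n (Or.inl hn)) (ih₂ fun s n hn => h s n (Or.inr hn))
  | ex s n φ ih =>
    exact exists_congr fun a => ih fun t m hm =>
      Assignment.update_congr a fun e => h t m ⟨hm, e⟩

end Struct

/-! ### Homomorphisms, positive formulas and embeddings -/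

namespace Hom

/-- The identity homomorphism. -/
def id (M : Struct L) : Hom M M where
  toFun _ a := a
  map_const _ := rfl
  map_rel _ _ h := h
  map_dist _ _ _ h := h

/-- Composition of homomorphisms. -/
def comp {M N P : Struct L} (g : Hom N P) (f : Hom M N) : Hom M P where
  toFun s a := g.toFun s (f.toFun s a)
  map_const c := by rw [f.map_const, g.map_const]
  map_rel R a h := g.map_rel R _ (f.map_rel R a h)
  map_dist d a b h := g.map_dist d _ _ (f.map_dist d a b h)

variable {M N : Struct L}

/-- The image of an assignment under a homomorphism. -/
def mapAssignment (f : Hom M N) (v : M.Assignment) : N.Assignment :=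
  fun s n => f.toFun s (v s n)

theorem mapAssignment_update (f : Hom M N) (v : M.Assignment) (s : L.Srt) (n : ℕ)
    (a : M.carrier s) :
    f.mapAssignment (v.update s n a) = (f.mapAssignment v).update s n (f.toFun s a) := by
  funext t m
  by_cases e : (t, m) = (s, n)
  · obtain ⟨rfl, rfl⟩ := Prod.mk.inj e
    simp only [mapAssignment, Struct.Assignment.update_self]
  · simp only [mapAssignment, Struct.Assignment.update_of_ne _ _ e]

theorem eval_mapAssignment (f : Hom M N) (v : M.Assignment) {s : L.Srt} (t : Term L s) :
    N.eval (f.mapAssignment v) t = f.toFun s (M.eval v t) := by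
  cases t with
  | var n => rfl
  | const c => exact (f.map_const c).symm

/-- Homomorphisms preserve positive formulas. -/
theorem sat_of_isPositive (f : Hom M N) {φ : Formula L} (hφ : φ.IsPositive) {v : M.Assignment}
    (h : M.Sat v φ) : N.Sat (f.mapAssignment v) φ := by
  induction hφ generalizing v with
  | top => trivial
  | bot => exact h
  | rel R t =>
    simp only [Struct.Sat, eval_mapAssignment]
    exact f.map_rel R _ h
  | dist d t₁ t₂ =>
    simp only [Struct.Sat, eval_mapAssignment]
    exact f.map_dist d _ _ h
  | and _ _ ih₁ ih₂ => exact ⟨ih₁ h.1, ih₂ h.2⟩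
  | or _ _ ih₁ ih₂ => exact h.imp ih₁ ih₂
  | ex s n _ ih =>
    obtain ⟨a, ha⟩ := h
    exact ⟨f.toFun s a, f.mapAssignment_update v s n a ▸ ih ha⟩

/-- An embedding reflects equality and all the other atomic relations. -/
structure IsEmbedding (f : Hom M N) : Prop where
  rel : ∀ (R : L.Rel) (a : ∀ i, M.carrier (L.relSort R i)),
    N.rel R (fun i => f.toFun _ (a i)) → M.rel R a
  dist : ∀ {s : L.Srt} (d : L.Dist s) (a b : M.carrier s),
    N.dist d (f.toFun s a) (f.toFun s b) → M.dist d a b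

theorem IsEmbedding.injective {f : Hom M N} (hf : f.IsEmbedding) (s : L.Srt) :
    Function.Injective (f.toFun s) := fun a b h =>
  (M.dist_one a b).1 (hf.dist 1 a b ((N.dist_one _ _).2 h))

theorem IsEmbedding.of_leftInverse (g : Hom N M) (f : Hom M N)
    (h : ∀ s a, g.toFun s (f.toFun s a) = a) : f.IsEmbedding where
  rel R a ha := by simpa only [h] using g.map_rel R _ ha
  dist d a b hab := by simpa only [h] using g.map_dist d _ _ hab

/-- The variables `(σ i, i)` have pairwise different indices, so the prescribed values never clash,
even when sorts repeat. -/
theorem exists_assignment_eq (M : Struct L) {n : ℕ} (σ : Fin n → L.Srt)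
    (a : ∀ i, M.carrier (σ i)) : ∃ v : M.Assignment, ∀ i, v (σ i) i = a i := by
  classical
  have h : ∀ (s : L.Srt) (m : ℕ), ∃ b : M.carrier s, ∀ i : Fin n, i.1 = m → ∀ e : σ i = s,
      e ▸ a i = b := by
    intro s m
    by_cases hm : ∃ i : Fin n, i.1 = m ∧ σ i = s
    · obtain ⟨i, rfl, rfl⟩ := hm
      refine ⟨a i, fun j hj e => ?_⟩
      obtain rfl := Fin.ext hj
      rfl
    · exact ⟨(M.nonempty s).some, fun i hi e => absurd ⟨i, hi, e⟩ hm⟩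
  choose v hv using h
  exact ⟨v, fun i => (hv _ _ i rfl rfl).symm⟩

theorem IsPositiveEmbedding.isEmbedding {f : Hom M N} (hf : f.IsPositiveEmbedding) :
    f.IsEmbedding where
  rel R a ha := by
    obtain ⟨v, hv⟩ := exists_assignment_eq M (L.relSort R) a
    have key := hf (.rel R fun i => .var i.1) (.rel _ _) v
    simp only [Struct.Sat, Struct.eval, hv] at key
    exact key ha
  dist {s} d a b hab := by
    have key := hf (.dist d (.var 0) (.var 1)) (.dist _ _ _)
      (Struct.Assignment.update (fun t _ => (M.nonempty t).some) s 0 a |>.update s 1 b)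
    simp only [Struct.Sat, Struct.eval, Struct.Assignment.update_self,
      Struct.Assignment.update_of_index_ne _ _ (zero_ne_one)] at key
    exact key hab

theorem IsEmbedding.isLocal {f : Hom M N} (hf : f.IsEmbedding) (hN : N.IsLocal) : M.IsLocal where
  symm d a b h := hf.dist d b a (hN.symm d _ _ (f.map_dist d a b h))
  mono d₁ d₂ h a b hab := hf.dist d₂ a b (hN.mono d₁ d₂ h _ _ (f.map_dist d₁ a b hab))
  comp d₁ d₂ a b c h₁ h₂ :=
    hf.dist _ a c (hN.comp d₁ d₂ _ _ _ (f.map_dist d₁ a b h₁) (f.map_dist d₂ b c h₂))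
  bound_const c₁ c₂ := hf.dist _ _ _ <| by
    rw [f.map_const, f.map_const]
    exact hN.bound_const c₁ c₂
  exists_dist a b := (hN.exists_dist (f.toFun _ a) (f.toFun _ b)).imp fun d h => hf.dist d a b h

/-- A surjective embedding has an inverse. -/
theorem IsEmbedding.exists_inverse {f : Hom M N} (hf : f.IsEmbedding)
    (hs : ∀ s, Function.Surjective (f.toFun s)) :
    ∃ g : Hom N M, ∀ s a, g.toFun s (f.toFun s a) = a := by
  choose g hg using hs
  refine ⟨⟨g, fun c => ?_, fun R a h => ?_, fun d a b h => ?_⟩, fun s a => ?_⟩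
  · exact hf.injective _ (by rw [hg, f.map_const])
  · exact hf.rel R _ (by simpa only [hg] using h)
  · exact hf.dist d _ _ (by simpa only [hg] using h)
  · exact hf.injective _ (hg _ _)

end Hom

/-! ### Local models of negative theories, substructures and atomic closedness -/

namespace Struct

variable {T : Set (Formula L)}

/-- A local structure is a local model of a negative theory if every positive sentence true in it is
true in some local model of the theory. -/
theorem IsLocal.isLocalModel (hT : IsNegativeLocalTheory T) {M : Struct L} (hM : M.IsLocal)
    (h : ∀ ψ : Formula L, ψ.IsPositive → ψ.IsSentence → ∀ v : M.Assignment, M.Sat v ψ →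
      ∃ N : Struct L, N.IsLocalModel T ∧ ∃ w : N.Assignment, N.Sat w ψ) :
    M.IsLocalModel T := by
  refine ⟨hM, fun φ hφ v => ?_⟩
  obtain ⟨⟨ψ, hψ, rfl⟩, hs⟩ := hT.1 φ hφ
  intro hv
  obtain ⟨N, hN, w, hw⟩ := h ψ hψ hs v hv
  exact hN.2 _ hφ w hw

theorem IsLocal.isLocalModel_of_hom (hT : IsNegativeLocalTheory T) {M N : Struct L}
    (hM : M.IsLocal) (hN : N.IsLocalModel T) (f : Hom M N) : M.IsLocalModel T :=
  hM.isLocalModel hT fun _ hψ _ _ hv => ⟨N, hN, _, f.sat_of_isPositive hψ hv⟩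

/-- The substructure on a family of nonempty sets containing the constants. -/
def restrict (M : Struct L) (S : ∀ s, Set (M.carrier s)) (hne : ∀ s, (S s).Nonempty)
    (hc : ∀ {s : L.Srt} (c : L.Const s), M.const c ∈ S s) : Struct L where
  carrier s := S s
  nonempty s := (hne s).to_subtype
  const c := ⟨M.const c, hc c⟩
  rel R a := M.rel R fun i => (a i).1
  dist d a b := M.dist d a.1 b.1
  dist_one a b := by rw [M.dist_one, Subtype.ext_iff]

section Restrict

variable (M : Struct L) (S : ∀ s, Set (M.carrier s)) (hne : ∀ s, (S s).Nonempty)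
    (hc : ∀ {s : L.Srt} (c : L.Const s), M.const c ∈ S s)

/-- The inclusion of a substructure. -/
def inclusion : Hom (M.restrict S hne hc) M where
  toFun _ a := a.1
  map_const _ := rfl
  map_rel _ _ h := h
  map_dist _ _ _ h := h

theorem inclusion_isEmbedding : (M.inclusion S hne hc).IsEmbedding where
  rel _ _ h := h
  dist _ _ _ h := h

end Restrict

end Struct

/-- A local model is atomically closed if all homomorphisms from it to local models are
embeddings. -/
def IsAtomicallyClosed (T : Set (Formula L)) (M : Struct L) : Prop :=
  M.IsLocalModel T ∧ ∀ N : Struct L, N.IsLocalModel T → ∀ f : Hom M N, f.IsEmbedding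

theorem IsLocalPositivelyClosed.isAtomicallyClosed {T : Set (Formula L)} {M : Struct L}
    (h : IsLocalPositivelyClosed T M) : IsAtomicallyClosed T M :=
  ⟨h.1, fun N hN f => (h.2 N hN f).isEmbedding⟩

/-! ### Directed colimits -/

/-- A diagram of structures and homomorphisms indexed by a preorder. -/
structure Diagram (L : LocalLanguage.{u}) (I : Type*) [Preorder I] where
  obj : I → Struct L
  map : ∀ {i j : I}, i ≤ j → Hom (obj i) (obj j)
  map_map : ∀ {i j k : I} (hij : i ≤ j) (hjk : j ≤ k) (s : L.Srt) (a : (obj i).carrier s),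
    (map hjk).toFun s ((map hij).toFun s a) = (map (hij.trans hjk)).toFun s a

theorem Diagram.mapAssignment_map {I : Type*} [Preorder I] (D : Diagram L I) {i j k : I}
    (hij : i ≤ j) (hjk : j ≤ k) (v : (D.obj i).Assignment) :
    (D.map hjk).mapAssignment ((D.map hij).mapAssignment v) =
      (D.map (hij.trans hjk)).mapAssignment v :=
  funext fun s => funext fun _ => D.map_map hij hjk s _

/-- A colimit, in the category of sets, of the underlying sets of a directed diagram. -/
structure Diagram.SetColimit {I : Type*} [Preorder I] (D : Diagram L I) where
  carrier : L.Srt → Type u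
  incl : ∀ (i : I) (s : L.Srt), (D.obj i).carrier s → carrier s
  incl_map : ∀ {i j : I} (h : i ≤ j) (s : L.Srt) (a : (D.obj i).carrier s),
    incl j s ((D.map h).toFun s a) = incl i s a
  surj : ∀ (s : L.Srt) (x : carrier s), ∃ i a, incl i s a = x
  exists_eq : ∀ {i : I} {s : L.Srt} {a b : (D.obj i).carrier s}, incl i s a = incl i s b →
    ∃ j, ∃ h : i ≤ j, (D.map h).toFun s a = (D.map h).toFun s b

namespace Diagram.SetColimit

variable {I : Type*} [Preorder I] [IsDirectedOrder I] {D : Diagram L I} (C : D.SetColimit)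

theorem exists_incl_eq₂ {s : L.Srt} (i : I) (x : C.carrier s) :
    ∃ j, i ≤ j ∧ ∃ a, C.incl j s a = x := by
  obtain ⟨k, a, rfl⟩ := C.surj s x
  obtain ⟨j, hi, hk⟩ := exists_ge_ge i k
  exact ⟨j, hi, _, C.incl_map hk s a⟩

theorem incl_const {s : L.Srt} (c : L.Const s) (i j : I) :
    C.incl i s ((D.obj i).const c) = C.incl j s ((D.obj j).const c) := by
  obtain ⟨k, hi, hj⟩ := exists_ge_ge i j
  rw [← C.incl_map hi, ← C.incl_map hj, (D.map hi).map_const, (D.map hj).map_const]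

variable [Nonempty I]

/-- The colimit of a directed diagram. -/
noncomputable def struct : Struct L where
  carrier := C.carrier
  nonempty s := ⟨C.incl (Classical.arbitrary I) s ((D.obj _).nonempty s).some⟩
  const {s} c := C.incl (Classical.arbitrary I) s ((D.obj _).const c)
  rel R x := ∃ i, ∃ a : ∀ t, (D.obj i).carrier (L.relSort R t),
    (D.obj i).rel R a ∧ ∀ t, C.incl i _ (a t) = x t
  dist {s} d x y := ∃ i, ∃ a b : (D.obj i).carrier s,
    (D.obj i).dist d a b ∧ C.incl i s a = x ∧ C.incl i s b = y
  dist_one {s} x y := by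
    constructor
    · rintro ⟨i, a, b, h, rfl, rfl⟩
      rw [((D.obj i).dist_one a b).1 h]
    · rintro rfl
      obtain ⟨i, a, rfl⟩ := C.surj s x
      exact ⟨i, a, a, ((D.obj i).dist_one a a).2 rfl, rfl, rfl⟩

/-- The homomorphism from an object of the diagram to the colimit. -/
noncomputable def inclHom (i : I) : Hom (D.obj i) C.struct where
  toFun := C.incl i
  map_const c := C.incl_const c _ _
  map_rel _ a h := ⟨i, a, h, fun _ => rfl⟩
  map_dist _ a b h := ⟨i, a, b, h, rfl, rfl⟩

/-- Directedness realizes finitely many identifications at one common stage; relations have finite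
arity, so this suffices for atomic formulas. -/
theorem exists_map_eq {i : I} {n : ℕ} {σ : Fin n → L.Srt} (a b : ∀ t, (D.obj i).carrier (σ t))
    (h : ∀ t, C.incl i _ (a t) = C.incl i _ (b t)) :
    ∃ j, ∃ hij : i ≤ j, ∀ t, (D.map hij).toFun _ (a t) = (D.map hij).toFun _ (b t) := by
  choose j hj e using fun t => C.exists_eq (h t)
  obtain ⟨k, hk⟩ := Finite.exists_le j
  obtain ⟨m, hkm, him⟩ := exists_ge_ge k i
  refine ⟨m, him, fun t => ?_⟩
  rw [← D.map_map (hj t) ((hk t).trans hkm), e t, D.map_map]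

/-- A relation between elements coming from `i` which holds in the colimit holds at a later
stage. -/
theorem exists_rel {i : I} (R : L.Rel) (a : ∀ t, (D.obj i).carrier (L.relSort R t))
    (h : C.struct.rel R fun t => C.incl i _ (a t)) :
    ∃ j, ∃ hij : i ≤ j, (D.obj j).rel R fun t => (D.map hij).toFun _ (a t) := by
  obtain ⟨k, b, hb, e⟩ := h
  obtain ⟨m, hk, hi⟩ := exists_ge_ge k i
  obtain ⟨n, hmn, hn⟩ := C.exists_map_eq (fun t => (D.map hk).toFun _ (b t))
    (fun t => (D.map hi).toFun _ (a t)) fun t => by rw [C.incl_map, C.incl_map, e]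
  refine ⟨n, hi.trans hmn, ?_⟩
  have := (D.map hmn).map_rel R _ ((D.map hk).map_rel R _ hb)
  simpa only [hn, D.map_map] using this

theorem exists_dist {i : I} {s : L.Srt} (d : L.Dist s) (a b : (D.obj i).carrier s)
    (h : C.struct.dist d (C.incl i s a) (C.incl i s b)) :
    ∃ j, ∃ hij : i ≤ j, (D.obj j).dist d ((D.map hij).toFun s a) ((D.map hij).toFun s b) := by
  obtain ⟨k, a', b', hab, ea, eb⟩ := h
  obtain ⟨m, hk, hi⟩ := exists_ge_ge k i
  obtain ⟨n, hmn, hn⟩ := C.exists_map_eq (n := 2) (σ := fun _ => s)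
    (fun t => (D.map hk).toFun _ (![a', b'] t))
    (fun t => (D.map hi).toFun _ (![a, b] t)) fun t => by
      rw [C.incl_map, C.incl_map]
      fin_cases t
      exacts [ea, eb]
  refine ⟨n, hi.trans hmn, ?_⟩
  have := (D.map hmn).map_dist d _ _ ((D.map hk).map_dist d _ _ hab)
  have h0 := hn 0
  have h1 := hn 1
  simp only [Matrix.cons_val_zero, Matrix.cons_val_one] at h0 h1
  simpa only [h0, h1, D.map_map] using this

theorem eval_eq {i : I} {v : (D.obj i).Assignment} {w : C.struct.Assignment} {s : L.Srt}
    (t : Term L s) (h : ∀ s n, (s, n) ∈ t.vars → C.incl i s (v s n) = w s n) :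
    C.struct.eval w t = C.incl i s ((D.obj i).eval v t) := by
  cases t with
  | var n => exact (h _ _ rfl).symm
  | const c => exact C.incl_const c _ _

/-- A positive formula about elements coming from `i` which holds in the colimit holds at a later
stage. -/
theorem exists_sat {φ : Formula L} (hφ : φ.IsPositive) {i : I} {v : (D.obj i).Assignment}
    {w : C.struct.Assignment} (h : ∀ s n, (s, n) ∈ φ.freeVars → C.incl i s (v s n) = w s n)
    (hw : C.struct.Sat w φ) :
    ∃ j, ∃ hij : i ≤ j, (D.obj j).Sat ((D.map hij).mapAssignment v) φ := by
  induction hφ generalizing i w with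
  | top => exact ⟨i, le_rfl, trivial⟩
  | bot => exact hw.elim
  | rel R t =>
    simp only [Struct.Sat] at hw ⊢
    simp only [Hom.eval_mapAssignment]
    refine C.exists_rel R _ ?_
    rwa [funext fun r => C.eval_eq (t r) fun s n hn => h s n (Set.mem_iUnion.2 ⟨r, hn⟩)] at hw
  | dist d t₁ t₂ =>
    simp only [Struct.Sat] at hw ⊢
    simp only [Hom.eval_mapAssignment]
    refine C.exists_dist d _ _ ?_
    rwa [C.eval_eq t₁ fun s n hn => h s n (Or.inl hn),
      C.eval_eq t₂ fun s n hn => h s n (Or.inr hn)] at hw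
  | and hφ hψ ih₁ ih₂ =>
    obtain ⟨j, hj, hj'⟩ := ih₁ (fun s n hn => h s n (Or.inl hn)) hw.1
    obtain ⟨k, hk, hk'⟩ := ih₂ (fun s n hn => h s n (Or.inr hn)) hw.2
    obtain ⟨m, hm, hm'⟩ := exists_ge_ge j k
    have h₁ := (D.map hm).sat_of_isPositive hφ hj'
    have h₂ := (D.map hm').sat_of_isPositive hψ hk'
    rw [D.mapAssignment_map] at h₁ h₂
    exact ⟨m, hj.trans hm, h₁, h₂⟩
  | or hφ hψ ih₁ ih₂ =>
    rcases hw with hw | hw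
    · obtain ⟨j, hj, hj'⟩ := ih₁ (fun s n hn => h s n (Or.inl hn)) hw
      exact ⟨j, hj, Or.inl hj'⟩
    · obtain ⟨j, hj, hj'⟩ := ih₂ (fun s n hn => h s n (Or.inr hn)) hw
      exact ⟨j, hj, Or.inr hj'⟩
  | ex s n hφ ih =>
    obtain ⟨x, hx⟩ := hw
    obtain ⟨k, hik, a, rfl⟩ := C.exists_incl_eq₂ i x
    obtain ⟨j, hkj, hj⟩ := ih (i := k) (v := ((D.map hik).mapAssignment v).update s n a)
      (fun t m hm => by
        by_cases e : (t, m) = (s, n)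
        · obtain ⟨rfl, rfl⟩ := Prod.mk.inj e
          exact (congrArg _ (Struct.Assignment.update_self ..)).trans
            (Struct.Assignment.update_self w t m (C.incl k t a)).symm
        · exact (congrArg _ (Struct.Assignment.update_of_ne _ _ e)).trans
            (((C.incl_map hik t _).trans (h t m ⟨hm, e⟩)).trans
              (Struct.Assignment.update_of_ne _ _ e).symm)) hx
    refine ⟨j, hik.trans hkj, (D.map hkj).toFun s a, ?_⟩
    rwa [Hom.mapAssignment_update, D.mapAssignment_map] at hj

theorem isLocal (h : ∀ i, (D.obj i).IsLocal) : C.struct.IsLocal where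
  symm := by
    rintro s d _ _ ⟨i, a, b, hab, rfl, rfl⟩
    exact ⟨i, b, a, (h i).symm d a b hab, rfl, rfl⟩
  mono := by
    rintro s d₁ d₂ hd _ _ ⟨i, a, b, hab, rfl, rfl⟩
    exact ⟨i, a, b, (h i).mono d₁ d₂ hd a b hab, rfl, rfl⟩
  comp := by
    rintro s d₁ d₂ _ _ z ⟨i, a, b, hab, rfl, rfl⟩ hz
    obtain ⟨j, hij, c, rfl⟩ := C.exists_incl_eq₂ i z
    rw [← C.incl_map hij] at hz
    obtain ⟨k, hjk, hk⟩ := C.exists_dist d₂ _ _ hz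
    refine ⟨k, _, _, (h k).comp d₁ d₂ _ _ _
      ((D.map hjk).map_dist _ _ _ ((D.map hij).map_dist _ _ _ hab)) hk, ?_, ?_⟩
    · rw [C.incl_map, C.incl_map]
    · rw [C.incl_map]
  bound_const c₁ c₂ := ⟨_, _, _, (h _).bound_const c₁ c₂, rfl, rfl⟩
  exists_dist := by
    intro s x y
    obtain ⟨i, a, rfl⟩ := C.surj s x
    obtain ⟨j, hij, b, rfl⟩ := C.exists_incl_eq₂ i y
    obtain ⟨d, hd⟩ := (h j).exists_dist ((D.map hij).toFun s a) b
    exact ⟨d, j, _, _, hd, C.incl_map hij s a, rfl⟩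

/-- A positive sentence true in the colimit is already true at some stage, which is a local model.
-/
theorem isLocalModel {T : Set (Formula L)} (hT : IsNegativeLocalTheory T)
    (h : ∀ i, (D.obj i).IsLocalModel T) : C.struct.IsLocalModel T := by
  refine (C.isLocal fun i => (h i).1).isLocalModel hT fun ψ hψ hs w hw => ?_
  obtain ⟨j, hij, hj⟩ := C.exists_sat hψ (i := Classical.arbitrary I)
    (v := fun s _ => ((D.obj _).nonempty s).some)
    (fun s n hn => by rw [hs] at hn; exact hn.elim) hw
  exact ⟨_, h j, _, hj⟩

/-- A homomorphism from the colimit is an embedding if its restrictions to all stages are. -/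
theorem isEmbedding {N : Struct L} (f : Hom C.struct N)
    (h : ∀ i, (f.comp (C.inclHom i)).IsEmbedding) : f.IsEmbedding where
  rel R x hx := by
    choose i a ha using fun t => C.surj _ (x t)
    obtain ⟨j, hj⟩ := Finite.exists_le i
    have e : ∀ t, x t = C.incl j _ ((D.map (hj t)).toFun _ (a t)) := fun t => by
      rw [C.incl_map, ha]
    exact ⟨j, _, (h j).rel R (fun t => (D.map (hj t)).toFun _ (a t))
      (by rw [funext e] at hx; exact hx), fun t => (e t).symm⟩
  dist {s} d x y hxy := by
    obtain ⟨i, a, rfl⟩ := C.surj s x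
    obtain ⟨j, hij, b, rfl⟩ := C.exists_incl_eq₂ i y
    rw [← C.incl_map hij] at hxy ⊢
    exact ⟨j, _, _, (h j).dist d ((D.map hij).toFun s a) b hxy, rfl, rfl⟩

end Diagram.SetColimit

/-! ### Existence of atomically closed models by maximal quotients -/

variable {T : Set (Formula L)}

/-- A local model of `T` which is a quotient set of `N`. -/
structure QuotientModel (T : Set (Formula L)) (N : Struct L) where
  obj : Struct L
  isLocalModel : obj.IsLocalModel T
  proj : Hom N obj
  surj : ∀ s, Function.Surjective (proj.toFun s)

namespace QuotientModel

variable {N : Struct L}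

instance : Preorder (QuotientModel T N) where
  le A B := ∃ h : Hom A.obj B.obj, ∀ s a, h.toFun s (A.proj.toFun s a) = B.proj.toFun s a
  le_refl A := ⟨Hom.id _, fun _ _ => rfl⟩
  le_trans A B C := by
    rintro ⟨f, hf⟩ ⟨g, hg⟩
    exact ⟨g.comp f, fun s a => by rw [← hg, ← hf]; rfl⟩

/-- The homomorphism witnessing an inequality of quotients. -/
noncomputable def homOfLE {A B : QuotientModel T N} (h : A ≤ B) : Hom A.obj B.obj := h.choose

theorem homOfLE_proj {A B : QuotientModel T N} (h : A ≤ B) (s : L.Srt) (a : N.carrier s) :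
    (homOfLE h).toFun s (A.proj.toFun s a) = B.proj.toFun s a := h.choose_spec s a

/-- The diagram of a set of quotients. -/
noncomputable def diagram (c : Set (QuotientModel T N)) : Diagram L c where
  obj A := A.1.obj
  map h := homOfLE h
  map_map {i j k} hij hjk s a := by
    obtain ⟨a, rfl⟩ := i.1.surj s a
    rw [homOfLE_proj hij, homOfLE_proj hjk, homOfLE_proj (hij.trans hjk)]

variable (c : Set (QuotientModel T N)) [IsDirectedOrder c] [Nonempty c]

/-- Two elements of `N` are equivalent if they are identified in a member of `c`. -/
def setoid (s : L.Srt) : Setoid (N.carrier s) where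
  r a b := ∃ A : c, A.1.proj.toFun s a = A.1.proj.toFun s b
  iseqv.refl _ := ⟨Classical.arbitrary c, rfl⟩
  iseqv.symm := fun ⟨A, h⟩ => ⟨A, h.symm⟩
  iseqv.trans := by
    rintro x y z ⟨A, hA⟩ ⟨B, hB⟩
    obtain ⟨C, hAC, hBC⟩ := exists_ge_ge A B
    refine ⟨C, ?_⟩
    rw [← homOfLE_proj hAC, hA, homOfLE_proj hAC, ← homOfLE_proj hBC, hB, homOfLE_proj hBC]

/-- The map from a member of `c` to the quotient of `N`. -/
noncomputable def incl (A : c) (s : L.Srt) (x : A.1.obj.carrier s) : Quotient (setoid c s) :=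
  Quotient.mk _ (Function.surjInv (A.1.surj s) x)

theorem incl_proj (A : c) (s : L.Srt) (a : N.carrier s) :
    incl c A s (A.1.proj.toFun s a) = Quotient.mk _ a :=
  Quotient.sound ⟨A, Function.surjInv_eq (A.1.surj s) _⟩

/-- The set of elements of `N`, modulo being identified in a member of `c`. -/
noncomputable def setColimit : (diagram c).SetColimit where
  carrier s := Quotient (setoid c s)
  incl := incl c
  incl_map {A B} h s x := by
    obtain ⟨a, rfl⟩ := A.1.surj s x
    exact (congrArg (incl c B s) (homOfLE_proj h s a)).trans
      ((incl_proj c B s a).trans (incl_proj c A s a).symm)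
  surj s x := by
    obtain ⟨a, rfl⟩ := Quotient.exists_rep x
    exact ⟨Classical.arbitrary c, _, incl_proj c _ s a⟩
  exists_eq {A s x y} h := by
    obtain ⟨a, rfl⟩ := A.1.surj s x
    obtain ⟨b, rfl⟩ := A.1.surj s y
    obtain ⟨B, hB⟩ := Quotient.exact
      (((incl_proj c A s a).symm.trans h).trans (incl_proj c A s b))
    obtain ⟨C, hAC, hBC⟩ := exists_ge_ge A B
    refine ⟨C, hAC, (homOfLE_proj hAC s a).trans (Eq.trans ?_ (homOfLE_proj hAC s b).symm)⟩
    rw [← homOfLE_proj hBC, hB, homOfLE_proj hBC]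

/-- The upper bound is the directed colimit. Its underlying sets are quotients of those of `N`, so
it stays in universe `u` although the index set `c` lives higher. -/
theorem bddAbove (hT : IsNegativeLocalTheory T) : BddAbove c := by
  let C := setColimit c
  refine ⟨⟨C.struct, C.isLocalModel hT fun A => A.1.isLocalModel,
    (C.inclHom (Classical.arbitrary c)).comp (Classical.arbitrary c).1.proj, fun s x => ?_⟩, ?_⟩
  · obtain ⟨a, rfl⟩ := Quotient.exists_rep x
    exact ⟨a, incl_proj c _ s a⟩
  · intro A hA
    exact ⟨C.inclHom ⟨A, hA⟩, fun s a =>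
      (incl_proj c ⟨A, hA⟩ s a).trans (incl_proj c _ s a).symm⟩

end QuotientModel

/-- Every local model has a homomorphism to an atomically closed one. -/
theorem exists_hom_isAtomicallyClosed (hT : IsNegativeLocalTheory T) {N : Struct L}
    (hN : N.IsLocalModel T) : ∃ K : Struct L, IsAtomicallyClosed T K ∧ Nonempty (Hom N K) := by
  have : Nonempty (QuotientModel T N) := ⟨⟨N, hN, Hom.id N, fun _ a => ⟨a, rfl⟩⟩⟩
  obtain ⟨K, hK⟩ := zorn_le_nonempty fun (c : Set (QuotientModel T N)) hc hne => by
    have : Nonempty c := hne.to_subtype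
    have : IsDirectedOrder c := ⟨hc.directedOn.directed_val⟩
    exact QuotientModel.bddAbove c hT
  refine ⟨K.obj, ⟨K.isLocalModel, fun P hP f => ?_⟩, ⟨K.proj⟩⟩
  -- The image of `K` in `P` is again a quotient model of `N`, lying above `K`. Maximality gives a
  -- homomorphism back, which is a left inverse because the projections are onto.
  have hne : ∀ s, (Set.range (f.toFun s)).Nonempty := fun s =>
    (@Set.range_nonempty _ _ (K.obj.nonempty s) _)
  have hc : ∀ {s : L.Srt} (c : L.Const s), P.const c ∈ Set.range (f.toFun s) := fun c =>
    ⟨_, f.map_const c⟩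
  let Q := P.restrict (fun s => Set.range (f.toFun s)) hne hc
  let g : Hom K.obj Q :=
    { toFun := fun s a => ⟨f.toFun s a, a, rfl⟩
      map_const := fun c => Subtype.ext (f.map_const c)
      map_rel := f.map_rel
      map_dist := f.map_dist }
  obtain ⟨h, hh⟩ := hK (b := ⟨Q, ((P.inclusion_isEmbedding _ hne hc).isLocal hP.1).isLocalModel_of_hom hT hP
    (P.inclusion _ hne hc), g.comp K.proj, fun s => by
      rintro ⟨_, a, rfl⟩
      obtain ⟨b, rfl⟩ := K.surj s a
      exact ⟨b, rfl⟩⟩) ⟨g, fun _ _ => rfl⟩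
  have hg : g.IsEmbedding := Hom.IsEmbedding.of_leftInverse h g fun s a => by
    obtain ⟨b, rfl⟩ := K.surj s a
    exact hh s b
  exact ⟨hg.rel, hg.dist⟩

/-! ### Bounded parts of reduced products -/

/-- A family of maps which, along a filter, eventually satisfies each instance of the definition of
a homomorphism. -/
structure ApproxHom {I : Type u} (F : Filter I) (N : Struct L) (M : I → Struct L) where
  toFun : ∀ i s, N.carrier s → (M i).carrier s
  map_const : ∀ {s : L.Srt} (c : L.Const s), ∀ᶠ i in F, toFun i s (N.const c) = (M i).const c
  map_rel : ∀ (R : L.Rel) (a : ∀ t, N.carrier (L.relSort R t)), N.rel R a →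
    ∀ᶠ i in F, (M i).rel R fun t => toFun i _ (a t)
  map_dist : ∀ {s : L.Srt} (d : L.Dist s) (a b : N.carrier s), N.dist d a b →
    ∀ᶠ i in F, (M i).dist d (toFun i s a) (toFun i s b)

namespace ApproxHom

variable {I : Type u} {F : Filter I} {N : Struct L} {M : I → Struct L} (g : ApproxHom F N M)

/-- The families of elements at bounded distance from the image of an element of `N`. -/
def BoundedFamily (s : L.Srt) : Type u :=
  {x : ∀ i, (M i).carrier s // ∃ (a : N.carrier s) (d : L.Dist s),
    ∀ᶠ i in F, (M i).dist d (x i) (g.toFun i s a)}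

/-- Eventual equality of bounded families. -/
def setoid (s : L.Srt) : Setoid (g.BoundedFamily s) where
  r x y := ∀ᶠ i in F, x.1 i = y.1 i
  iseqv.refl _ := .of_forall fun _ => rfl
  iseqv.symm h := h.mono fun _ => Eq.symm
  iseqv.trans h h' := by
    filter_upwards [h, h'] with i hi hi'
    exact hi.trans hi'

/-- The bounded family of images of an element of `N`. -/
def image (s : L.Srt) (a : N.carrier s) : g.BoundedFamily s :=
  ⟨fun i => g.toFun i s a, a, 1, .of_forall fun i => ((M i).dist_one _ _).2 rfl⟩

variable {g}

/-- A representative of an element of the reduced product. -/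
noncomputable def rep {s : L.Srt} (x : Quotient (g.setoid s)) (i : I) : (M i).carrier s := x.out.1 i

theorem rep_mk {s : L.Srt} (x : g.BoundedFamily s) :
    ∀ᶠ i in F, rep (Quotient.mk (g.setoid s) x) i = x.1 i :=
  Quotient.exact (Quotient.out_eq (Quotient.mk (g.setoid s) x))

theorem eq_of_rep {s : L.Srt} {x y : Quotient (g.setoid s)} (h : ∀ᶠ i in F, rep x i = rep y i) :
    x = y := by
  rw [← x.out_eq, ← y.out_eq]
  exact Quotient.sound h

variable (g)

/-- The part of the reduced product of the structures `M i` at bounded distance from the image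
of `N`. -/
noncomputable def localProduct : Struct L where
  carrier s := Quotient (g.setoid s)
  nonempty s := ⟨Quotient.mk _ (g.image s (N.nonempty s).some)⟩
  const c := Quotient.mk _ (g.image _ (N.const c))
  rel R x := ∀ᶠ i in F, (M i).rel R fun t => rep (x t) i
  dist d x y := ∀ᶠ i in F, (M i).dist d (rep x i) (rep y i)
  dist_one x y := by
    simp only [Struct.dist_one]
    exact ⟨eq_of_rep, fun h => h ▸ .of_forall fun _ => rfl⟩

/-- The homomorphism to the reduced product. -/
noncomputable def toHom : Hom N g.localProduct where
  toFun s a := Quotient.mk _ (g.image s a)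
  map_const _ := rfl
  map_rel R a h := by
    filter_upwards [g.map_rel R a h, Filter.eventually_all.2 fun t => rep_mk (g.image _ (a t))]
      with i hi e
    simp only [e]
    exact hi
  map_dist d a b h := by
    filter_upwards [g.map_dist d a b h, rep_mk (g.image _ a), rep_mk (g.image _ b)] with i hi e e'
    rw [e, e']
    exact hi

/-- Only `exists_dist` needs the restriction to bounded families: two of them are joined by passing
through their anchors in `N`, which are themselves at some distance `e`. -/
theorem isLocal (hN : N.IsLocal) (h : ∀ i, (M i).IsLocal) : g.localProduct.IsLocal where
  symm d x y hxy := hxy.mono fun i => (h i).symm d _ _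
  mono d₁ d₂ hd x y hxy := hxy.mono fun i => (h i).mono d₁ d₂ hd _ _
  comp d₁ d₂ x y z hxy hyz := by
    filter_upwards [hxy, hyz] with i h₁ h₂
    exact (h i).comp d₁ d₂ _ _ _ h₁ h₂
  bound_const c₁ c₂ := g.toHom.map_dist _ _ _ (hN.bound_const c₁ c₂)
  exists_dist {s} x y := by
    obtain ⟨a, d, hd⟩ := x.out.2
    obtain ⟨b, d', hd'⟩ := y.out.2
    obtain ⟨e, he⟩ := hN.exists_dist a b
    refine ⟨d * e * d', ?_⟩
    filter_upwards [hd, hd', g.map_dist e a b he] with i h₁ h₂ h₃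
    exact (h i).comp _ _ _ _ _ ((h i).comp _ _ _ _ _ h₁ h₃) ((h i).symm _ _ _ h₂)

theorem rep_eval (v : g.localProduct.Assignment) {s : L.Srt} (t : Term L s) :
    ∀ᶠ i in F, rep (g.localProduct.eval v t) i = (M i).eval (fun s n => rep (v s n) i) t := by
  cases t with
  | var n => exact .of_forall fun _ => rfl
  | const c =>
    filter_upwards [rep_mk (g.image s (N.const c)), g.map_const c] with i h₁ h₂
    exact h₁.trans h₂

/-- For positive formulas only this direction is needed, so any filter will do: a true disjunction
already has a true disjunct in the product. -/
theorem eventually_sat {φ : Formula L} (hφ : φ.IsPositive) {v : g.localProduct.Assignment}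
    (hv : g.localProduct.Sat v φ) : ∀ᶠ i in F, (M i).Sat (fun s n => rep (v s n) i) φ := by
  induction hφ generalizing v with
  | top => exact .of_forall fun _ => trivial
  | bot => exact hv.elim
  | rel R t =>
    filter_upwards [hv, Filter.eventually_all.2 fun r => g.rep_eval v (t r)] with i hi e
    simpa only [Struct.Sat, e] using hi
  | dist d t₁ t₂ =>
    filter_upwards [hv, g.rep_eval v t₁, g.rep_eval v t₂] with i hi e₁ e₂
    simpa only [Struct.Sat, e₁, e₂] using hi
  | and _ _ ih₁ ih₂ =>
    filter_upwards [ih₁ hv.1, ih₂ hv.2] with i h₁ h₂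
    exact ⟨h₁, h₂⟩
  | or _ _ ih₁ ih₂ =>
    rcases hv with hv | hv
    · exact (ih₁ hv).mono fun i => Or.inl
    · exact (ih₂ hv).mono fun i => Or.inr
  | ex s n _ ih =>
    obtain ⟨x, hx⟩ := hv
    refine (ih hx).mono fun i hi => ⟨rep x i, ?_⟩
    convert hi using 1
    funext t m
    by_cases e : (t, m) = (s, n)
    · obtain ⟨rfl, rfl⟩ := Prod.mk.inj e
      rw [Struct.Assignment.update_self, Struct.Assignment.update_self]
    · rw [Struct.Assignment.update_of_ne _ _ e, Struct.Assignment.update_of_ne _ _ e]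

theorem isLocalModel {T : Set (Formula L)} (hT : IsNegativeLocalTheory T) [F.NeBot]
    (hN : N.IsLocal) (h : ∀ i, (M i).IsLocalModel T) : g.localProduct.IsLocalModel T := by
  refine (g.isLocal hN fun i => (h i).1).isLocalModel hT fun ψ hψ _ v hv => ?_
  obtain ⟨i, hi⟩ := (g.eventually_sat hψ hv).exists
  exact ⟨M i, h i, _, hi⟩

end ApproxHom

/-! ### Separating points by local positive formulas -/

/-- The atomic facts in a structure. -/
inductive Fact (N : Struct L) : Type u
  | rel (R : L.Rel) (a : ∀ i, N.carrier (L.relSort R i)) (h : N.rel R a) : Fact N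
  | dist {s : L.Srt} (d : L.Dist s) (a b : N.carrier s) (h : N.dist d a b) : Fact N
  | const {s : L.Srt} (c : L.Const s) : Fact N

namespace Fact

variable {N : Struct L}

/-- The elements occurring in a fact. -/
def elems : Fact N → List (Σ s, N.carrier s)
  | .rel _ a _ => List.ofFn fun i => ⟨_, a i⟩
  | .dist _ a b _ => [⟨_, a⟩, ⟨_, b⟩]
  | .const c => [⟨_, N.const c⟩]

/-- The formula expressing a fact, where `e` indexes the variables denoting the elements. -/
def formula (e : (Σ s, N.carrier s) → ℕ) : Fact N → Formula L
  | .rel R a _ => .rel R fun i => .var (e ⟨_, a i⟩)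
  | .dist d a b _ => .dist d (.var (e ⟨_, a⟩)) (.var (e ⟨_, b⟩))
  | .const c => .dist 1 (.var (e ⟨_, N.const c⟩)) (.const c)

/-- The map `g` preserves a fact. -/
def Holds (M : Struct L) (g : ∀ s, N.carrier s → M.carrier s) : Fact N → Prop
  | .rel R a _ => M.rel R fun i => g _ (a i)
  | .dist d a b _ => M.dist d (g _ a) (g _ b)
  | .const c => g _ (N.const c) = M.const c

theorem sat_formula (e : (Σ s, N.carrier s) → ℕ) (M : Struct L) (v : M.Assignment) (f : Fact N) :
    M.Sat v (f.formula e) ↔ f.Holds M fun s a => v s (e ⟨s, a⟩) := by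
  cases f with
  | rel R a h => exact Iff.rfl
  | dist d a b h => exact Iff.rfl
  | const c => exact M.dist_one _ _

theorem holds_id (f : Fact N) : f.Holds N fun _ a => a := by
  cases f with
  | rel R a h => exact h
  | dist d a b h => exact h
  | const c => rfl

theorem holds_congr {M : Struct L} {g g' : ∀ s, N.carrier s → M.carrier s} (f : Fact N)
    (h : ∀ n ∈ f.elems, g n.1 n.2 = g' n.1 n.2) : f.Holds M g ↔ f.Holds M g' := by
  cases f with
  | rel R a _ =>
    simp only [Holds]
    rw [funext fun i => h ⟨_, a i⟩ (List.mem_ofFn.2 ⟨i, rfl⟩)]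
  | dist d a b _ =>
    simp only [Holds]
    rw [h ⟨_, a⟩ (by simp [elems]), h ⟨_, b⟩ (by simp [elems])]
  | const c =>
    simp only [Holds]
    rw [h ⟨_, N.const c⟩ (by simp [elems])]

theorem freeVars_formula (e : (Σ s, N.carrier s) → ℕ) (f : Fact N) :
    (f.formula e).freeVars ⊆ {w | ∃ n ∈ f.elems, w = (n.1, e n)} := by
  cases f with
  | rel R a _ =>
    refine Set.iUnion_subset fun i => ?_
    rintro _ rfl
    exact ⟨_, List.mem_ofFn.2 ⟨i, rfl⟩, rfl⟩
  | dist d a b _ =>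
    rintro _ (rfl | rfl)
    · exact ⟨⟨_, a⟩, by simp [elems], rfl⟩
    · exact ⟨⟨_, b⟩, by simp [elems], rfl⟩
  | const c =>
    rintro _ (rfl | h)
    · exact ⟨⟨_, N.const c⟩, by simp [elems], rfl⟩
    · exact h.elim

theorem isLocalPositive_formula (e : (Σ s, N.carrier s) → ℕ) (f : Fact N) :
    (f.formula e).IsLocalPositive := by
  cases f with
  | rel R a _ => exact .rel _ _
  | dist d a b _ => exact .dist _ _ _
  | const c => exact .dist _ _ _

end Fact

namespace Formula

/-- The conjunction of a list of formulas. -/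
def conj (l : List (Formula L)) : Formula L := l.foldr .and .top

theorem sat_conj (M : Struct L) (v : M.Assignment) (l : List (Formula L)) :
    M.Sat v (conj l) ↔ ∀ φ ∈ l, M.Sat v φ := by
  induction l with
  | nil => simp [conj, Struct.Sat]
  | cons φ l ih =>
    rw [List.forall_mem_cons, ← ih]
    exact Iff.rfl

theorem freeVars_conj (l : List (Formula L)) {w : Var L} (hw : w ∈ (conj l).freeVars) :
    ∃ φ ∈ l, w ∈ φ.freeVars := by
  induction l with
  | nil => exact hw.elim
  | cons φ l ih =>
    rcases hw with hw | hw
    · exact ⟨φ, by simp, hw⟩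
    · obtain ⟨ψ, hψ, h⟩ := ih hw
      exact ⟨ψ, by simp [hψ], h⟩

theorem isLocalPositive_conj {l : List (Formula L)} (h : ∀ φ ∈ l, φ.IsLocalPositive) :
    (conj l).IsLocalPositive := by
  induction l with
  | nil => exact .top
  | cons φ l ih =>
    rw [List.forall_mem_cons] at h
    exact .and h.1 (ih h.2)

/-- Quantification over a list of variables, each at a given distance from the variable with index
`0` of the same sort. -/
def locExs (l : List (Σ s, ℕ × L.Dist s)) (φ : Formula L) : Formula L :=
  l.foldr (fun q ψ => .ex q.1 q.2.1 (.and (.dist q.2.2 (.var q.2.1) (.var 0)) ψ)) φ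

theorem isLocalPositive_locExs {l : List (Σ s, ℕ × L.Dist s)} {φ : Formula L}
    (hl : ∀ q ∈ l, q.2.1 ≠ 0) (h : φ.IsLocalPositive) : (locExs l φ).IsLocalPositive := by
  induction l with
  | nil => exact h
  | cons q l ih =>
    rw [List.forall_mem_cons] at hl
    exact .locEx _ _ _ (fun e => hl.1 (by injection e with e; exact e.symm)) (ih hl.2)

/-- Local quantification binds the listed variables at the price of adding base-point variables,
those of index `0`. -/
theorem freeVars_locExs (l : List (Σ s, ℕ × L.Dist s)) (φ : Formula L) {w : Var L}
    (hw : w ∈ (locExs l φ).freeVars) :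
    w.2 = 0 ∨ w ∈ φ.freeVars ∧ ∀ q ∈ l, w ≠ (q.1, q.2.1) := by
  induction l with
  | nil => exact Or.inr ⟨hw, by simp⟩
  | cons q l ih =>
    obtain ⟨(rfl | rfl) | hw, hne⟩ := hw
    · exact absurd rfl hne
    · exact Or.inl rfl
    · rcases ih hw with h | ⟨h, h'⟩
      · exact Or.inl h
      · exact Or.inr ⟨h, List.forall_mem_cons.2 ⟨hne, h'⟩⟩

theorem exists_sat_of_sat_locExs {M : Struct L} {v : M.Assignment} {l : List (Σ s, ℕ × L.Dist s)}
    {φ : Formula L} (h : M.Sat v (locExs l φ)) :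
    ∃ w : M.Assignment, M.Sat w φ ∧ ∀ s n, (∀ q ∈ l, (s, n) ≠ (q.1, q.2.1)) → w s n = v s n := by
  induction l generalizing v with
  | nil => exact ⟨v, h, fun _ _ _ => rfl⟩
  | cons q l ih =>
    obtain ⟨a, -, ha⟩ := h
    obtain ⟨w, hw, e⟩ := ih ha
    refine ⟨w, hw, fun s n hn => ?_⟩
    rw [List.forall_mem_cons] at hn
    rw [e s n hn.2, Struct.Assignment.update_of_ne _ _ hn.1]

/-- The assignment `w` holds all witnesses at once. Since index `0` is never quantified, the base
points stay fixed while the witnesses are inserted one by one. -/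
theorem sat_locExs {M : Struct L} {v w : M.Assignment} {l : List (Σ s, ℕ × L.Dist s)}
    {φ : Formula L} (h : M.Sat w φ) (hl : ∀ q ∈ l, q.2.1 ≠ 0)
    (hd : ∀ q ∈ l, M.dist q.2.2 (w q.1 q.2.1) (w q.1 0))
    (e : ∀ s n, (∀ q ∈ l, (s, n) ≠ (q.1, q.2.1)) → w s n = v s n) :
    M.Sat v (locExs l φ) := by
  induction l generalizing v with
  | nil =>
    obtain rfl : w = v := funext fun s => funext fun n => e s n (by simp)
    exact h
  | cons q l ih =>
    have hl' := List.forall_mem_cons.1 hl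
    have hd' := List.forall_mem_cons.1 hd
    refine ⟨w q.1 q.2.1, ?_, ih hl'.2 hd'.2 fun s n hn => ?_⟩
    · simp only [Struct.Sat, Struct.eval, Struct.Assignment.update_self]
      rw [Struct.Assignment.update_of_index_ne _ _ hl'.1.symm, ← e q.1 0 fun p hp he =>
        hl p hp (congrArg Prod.snd he).symm]
      exact hd'.1
    · by_cases hq : (s, n) = (q.1, q.2.1)
      · obtain ⟨rfl, rfl⟩ := Prod.mk.inj hq
        rw [Struct.Assignment.update_self]
      · rw [Struct.Assignment.update_of_ne _ _ hq]
        exact e s n (List.forall_mem_cons.2 ⟨hq, hn⟩)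

/-- A local positive formula in the variables `(s, 1)`, `(s, 2)` and variables with index `0` which
implies that the values of `(s, 1)` and `(s, 2)` are distinct in the local models of `T`. -/
structure Separates (T : Set (Formula L)) (s : L.Srt) (φ : Formula L) : Prop where
  isLocalPositive : φ.IsLocalPositive
  freeVars : φ.freeVars ⊆ {(s, 1), (s, 2)} ∪ {w | w.2 = 0}
  denial : ∀ M : Struct L, M.IsLocalModel T → ∀ v : M.Assignment, v s 1 = v s 2 → ¬ M.Sat v φ

end Formula

/-- The assignment of `a` to `(s, 1)`, of `b` to `(s, 2)` and of `o t` to all other variables of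
sort `t`. -/
noncomputable def Struct.pairAssignment {M : Struct L} (o : ∀ s, M.carrier s) {s : L.Srt}
    (a b : M.carrier s) : M.Assignment :=
  Struct.Assignment.update (Struct.Assignment.update (fun t _ => o t) s 1 a) s 2 b

section

variable {M : Struct L} (o : ∀ s, M.carrier s) {s : L.Srt} (a b : M.carrier s)

theorem Struct.pairAssignment_one : Struct.pairAssignment o a b s 1 = a := by
  rw [pairAssignment, Assignment.update_of_index_ne _ _ (by decide), Assignment.update_self]

theorem Struct.pairAssignment_two : Struct.pairAssignment o a b s 2 = b :=
  Assignment.update_self _ _ _ _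

theorem Struct.pairAssignment_of_ne {t : L.Srt} {n : ℕ} (h₁ : n ≠ 1) (h₂ : n ≠ 2) :
    Struct.pairAssignment o a b t n = o t := by
  rw [pairAssignment, Assignment.update_of_index_ne _ _ h₂, Assignment.update_of_index_ne _ _ h₁]

end

open Classical in
/-- If no formula separates `a` from `b`, then finitely many facts can be preserved by a map which
identifies `a` and `b`. -/
theorem exists_holds_and_eq {N : Struct L} (hN : N.IsLocal) (o : ∀ s, N.carrier s) {s : L.Srt}
    {a b : N.carrier s}
    (h : ∀ φ : Formula L, φ.Separates T s → ¬ N.Sat (Struct.pairAssignment o a b) φ)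
    (l : List (Fact N)) :
    ∃ M : Struct L, M.IsLocalModel T ∧ ∃ g : ∀ s, N.carrier s → M.carrier s,
      (∀ f ∈ l, f.Holds M g) ∧ g s a = g s b := by
  -- `E` lists the elements to be named. The shift by `3` in `e` keeps index `0` for base points and
  -- `1`, `2` for the two elements under comparison.
  let E : List (Σ s, N.carrier s) := ⟨s, a⟩ :: ⟨s, b⟩ :: l.flatMap Fact.elems
  let e : (Σ s, N.carrier s) → ℕ := fun n => E.idxOf n + 3
  choose d hd using fun n : Σ s, N.carrier s => hN.exists_dist n.2 (o n.1)
  let Q : List (Σ s, ℕ × L.Dist s) := E.map fun n => ⟨n.1, e n, d n⟩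
  -- Quantifying the named elements locally in `φ₀` gives a formula true of `a`, `b` in `N`. By `h`
  -- it cannot separate, so some local model satisfies it with both variables equal.
  let φ₀ : Formula L := .and (.and (.dist 1 (.var (s := s) 1) (.var (e ⟨s, a⟩)))
    (.dist 1 (.var (s := s) 2) (.var (e ⟨s, b⟩)))) (.conj (l.map (Fact.formula e)))
  have hQ : ∀ q ∈ Q, 3 ≤ q.2.1 := by
    intro q hq
    obtain ⟨n, -, rfl⟩ := List.mem_map.1 hq
    exact Nat.le_add_left _ _
  have hQ0 : ∀ q ∈ Q, q.2.1 ≠ 0 := fun q hq => by have := hQ q hq; omega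
  have hE : ∀ f ∈ l, ∀ n ∈ f.elems, n ∈ E := fun f hf n hn => by
    simp only [E, List.mem_cons, List.mem_flatMap]
    exact Or.inr (Or.inr ⟨f, hf, hn⟩)
  have haE : ⟨s, a⟩ ∈ E := by simp [E]
  have hbE : ⟨s, b⟩ ∈ E := by simp [E]
  have hpos : (Formula.locExs Q φ₀).IsLocalPositive := by
    refine Formula.isLocalPositive_locExs hQ0 (.and (.and (.dist _ _ _) (.dist _ _ _))
      (Formula.isLocalPositive_conj fun ψ hψ => ?_))
    obtain ⟨f, -, rfl⟩ := List.mem_map.1 hψ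
    exact f.isLocalPositive_formula e
  have hfree : (Formula.locExs Q φ₀).freeVars ⊆ {(s, 1), (s, 2)} ∪ {w | w.2 = 0} := by
    intro w hw
    have hout : ∀ n ∈ E, (∀ q ∈ Q, w ≠ (q.1, q.2.1)) → w ≠ (n.1, e n) := fun n hn hw' =>
      hw' _ (List.mem_map.2 ⟨n, hn, rfl⟩)
    rcases Formula.freeVars_locExs _ _ hw with h0 | ⟨((h1 | h1) | (h1 | h1)) | h1, h2⟩
    · exact Or.inr h0
    · exact Or.inl (Or.inl h1)
    · exact absurd h1 (hout ⟨s, a⟩ haE h2)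
    · exact Or.inl (Or.inr h1)
    · exact absurd h1 (hout ⟨s, b⟩ hbE h2)
    · obtain ⟨ψ, hψ, hw'⟩ := Formula.freeVars_conj _ h1
      obtain ⟨f, hf, rfl⟩ := List.mem_map.1 hψ
      obtain ⟨n, hn, e'⟩ := f.freeVars_formula e hw'
      exact absurd e' (hout n (hE f hf n hn) h2)
  have hsat : N.Sat (Struct.pairAssignment o a b) (Formula.locExs Q φ₀) := by
    -- The witnessing assignment sends the variable of each listed element to that element and
    -- agrees with `pairAssignment` elsewhere; it is well defined because `idxOf` is injective on
    -- `E`.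
    have hw : ∀ (t : L.Srt) (k : ℕ), ∃ x : N.carrier t,
        (∀ n : N.carrier t, ⟨t, n⟩ ∈ E → e ⟨t, n⟩ = k → x = n) ∧
        ((∀ q ∈ Q, (t, k) ≠ (q.1, q.2.1)) → x = Struct.pairAssignment o a b t k) := by
      intro t k
      by_cases hn : ∃ n : N.carrier t, ⟨t, n⟩ ∈ E ∧ e ⟨t, n⟩ = k
      · obtain ⟨n, hn, rfl⟩ := hn
        refine ⟨n, fun m hm hmn => ?_, fun hq => absurd rfl (hq _ (List.mem_map.2 ⟨_, hn, rfl⟩))⟩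
        have := (List.idxOf_inj hm).1 (Nat.add_right_cancel hmn)
        exact (eq_of_heq (Sigma.mk.inj this).2).symm
      · exact ⟨_, fun n h₁ h₂ => absurd ⟨n, h₁, h₂⟩ hn, fun _ => rfl⟩
    choose w hw₁ hw₂ using hw
    have hwe : ∀ n ∈ E, w n.1 (e n) = n.2 := fun n hn => hw₁ n.1 _ n.2 hn rfl
    have hws : ∀ t k, k < 3 → w t k = Struct.pairAssignment o a b t k := fun t k hk =>
      hw₂ t k fun q hq hqk => by
        have := hQ q hq
        rw [← (Prod.mk.inj hqk).2] at this
        omega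
    refine Formula.sat_locExs (w := w) ⟨⟨?_, ?_⟩, ?_⟩ hQ0 ?_ hw₂
    · refine (N.dist_one _ _).2 ?_
      simp only [Struct.eval]
      rw [hwe ⟨s, a⟩ haE, hws _ _ (by decide), Struct.pairAssignment_one]
    · refine (N.dist_one _ _).2 ?_
      simp only [Struct.eval]
      rw [hwe ⟨s, b⟩ hbE, hws _ _ (by decide), Struct.pairAssignment_two]
    · rw [Formula.sat_conj]
      intro ψ hψ
      obtain ⟨f, hf, rfl⟩ := List.mem_map.1 hψ
      rw [Fact.sat_formula]
      exact (f.holds_congr fun n hn => hwe n (hE f hf n hn)).2 f.holds_id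
    · intro q hq
      obtain ⟨n, hn, rfl⟩ := List.mem_map.1 hq
      simp only
      rw [hwe n hn, hws _ _ (by decide), Struct.pairAssignment_of_ne _ _ _ (by decide) (by decide)]
      exact hd n
  have hden : ¬ ∀ M : Struct L, M.IsLocalModel T → ∀ v : M.Assignment, v s 1 = v s 2 →
      ¬ M.Sat v (Formula.locExs Q φ₀) := fun hden => h _ ⟨hpos, hfree, hden⟩ hsat
  push Not at hden
  obtain ⟨M, hM, v, hv, hvs⟩ := hden
  obtain ⟨w, ⟨⟨hwa, hwb⟩, hwl⟩, hw⟩ := Formula.exists_sat_of_sat_locExs hvs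
  have hws : ∀ t k, k < 3 → w t k = v t k := fun t k hk => hw t k fun q hq hqk => by
    have := hQ q hq
    rw [← (Prod.mk.inj hqk).2] at this
    omega
  refine ⟨M, hM, fun t n => w t (e ⟨t, n⟩), fun f hf => ?_, ?_⟩
  · rw [← Fact.sat_formula]
    exact (Formula.sat_conj _ _ _).1 hwl _ (List.mem_map.2 ⟨f, hf, rfl⟩)
  · have h₁ := (M.dist_one _ _).1 hwa
    have h₂ := (M.dist_one _ _).1 hwb
    simp only [Struct.eval] at h₁ h₂
    show w s (e ⟨s, a⟩) = w s (e ⟨s, b⟩)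
    rw [← h₁, ← h₂, hws _ _ (by decide), hws _ _ (by decide), hv]

/-- Distinct elements of an atomically closed model are separated by a formula with parameters
among given base points. -/
theorem IsAtomicallyClosed.exists_separates (hT : IsNegativeLocalTheory T) {N : Struct L}
    (hN : IsAtomicallyClosed T N) (o : ∀ s, N.carrier s) {s : L.Srt} {a b : N.carrier s}
    (hab : a ≠ b) :
    ∃ φ : Formula L, φ.Separates T s ∧ N.Sat (Struct.pairAssignment o a b) φ := by
  by_contra! h
  -- One model for each finite set of facts. Along `atTop` every single fact is eventually
  -- preserved, while `a` and `b` are identified throughout.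
  choose M hM g hg e using fun δ : Finset (Fact N) => exists_holds_and_eq hN.1.1 o h δ.toList
  have hev : ∀ f : Fact N, ∀ᶠ δ in (Filter.atTop : Filter (Finset (Fact N))),
      f.Holds (M δ) (g δ) := fun f =>
    (Filter.eventually_ge_atTop {f}).mono fun δ hδ => hg δ f (by simpa using hδ)
  let G : ApproxHom (Filter.atTop : Filter (Finset (Fact N))) N M :=
    { toFun := g
      map_const := fun c => hev (.const c)
      map_rel := fun R a ha => hev (.rel R a ha)
      map_dist := fun d a b hd => hev (.dist d a b hd) }
  refine hab ((hN.2 _ (G.isLocalModel hT hN.1.1 hM) G.toHom).injective s ?_)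
  exact Quotient.sound (.of_forall e)

theorem Formula.exists_sat_of_sat_exs {M : Struct L} {v : M.Assignment} {z : List (Var L)}
    {φ : Formula L} (h : M.Sat v (.exs z φ)) :
    ∃ w : M.Assignment, M.Sat w φ ∧ ∀ s n, (s, n) ∉ z → w s n = v s n := by
  induction z generalizing v with
  | nil => exact ⟨v, h, fun _ _ _ => rfl⟩
  | cons q z ih =>
    obtain ⟨a, ha⟩ := h
    obtain ⟨w, hw, e⟩ := ih ha
    refine ⟨w, hw, fun s n hn => ?_⟩
    rw [List.mem_cons, not_or] at hn
    rw [e s n hn.2, Struct.Assignment.update_of_ne _ _ hn.1]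

/-! ### Compactness: no infinite separated chains in balls -/

/-- The formula obtained by exchanging the variables `(s, 1)` and `(s, 2)`. -/
def Formula.swap (s : L.Srt) (φ : Formula L) : Formula L :=
  .ex s 3 (.and (.dist (s := s) 1 (.var 3) (.var 1))
    (.ex s 1 (.and (.dist (s := s) 1 (.var 1) (.var 2))
      (.ex s 2 (.and (.dist (s := s) 1 (.var 2) (.var 3)) φ)))))

/-- Equality is the locality relation `1`, so `∃ x, x = t ∧ ·` is a local quantifier that simulates
substitution. The variable `(s, 3)` is temporary storage. -/
theorem Formula.sat_swap {M : Struct L} (v : M.Assignment) (s : L.Srt) (φ : Formula L) :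
    M.Sat v (φ.swap s) ↔
      M.Sat (((v.update s 3 (v s 1)).update s 1 (v s 2)).update s 2 (v s 1)) φ := by
  have h32 : (3 : ℕ) ≠ 2 := by decide
  have h31 : (3 : ℕ) ≠ 1 := by decide
  simp [swap, Struct.Sat, Struct.eval, M.dist_one, Struct.Assignment.update_self,
    Struct.Assignment.update_of_index_ne, h32, h31]

/-- Compactness speaks of all pairs `p ≠ q`, a chain only of pairs `i < j`; symmetrizing the formula
bridges the gap. -/
theorem Formula.Separates.or_swap {s : L.Srt} {φ : Formula L} (h : φ.Separates T s) :
    (Formula.or φ (φ.swap s)).Separates T s where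
  isLocalPositive := .or h.isLocalPositive <|
    .locEx _ _ _ (by simp) <| .locEx _ _ _ (by simp) <| .locEx _ _ _ (by simp) h.isLocalPositive
  freeVars := by
    refine Set.union_subset h.freeVars ?_
    rintro w ⟨(h3 | h1) | ⟨(h1 | h2) | ⟨(h2 | h3) | h', h2'⟩, h1'⟩, h3'⟩
    · exact absurd h3 h3'
    · exact Or.inl (Or.inl h1)
    · exact absurd h1 h1'
    · exact Or.inl (Or.inr h2)
    · exact absurd h2 h2'
    · exact absurd h3 h3'
    · exact h.freeVars h'
  denial M hM v hv hs := by
    rcases hs with hs | hs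
    · exact h.denial M hM v hv hs
    · rw [Formula.sat_swap] at hs
      refine h.denial M hM _ ?_ hs
      rw [Struct.Assignment.update_self, Struct.Assignment.update_of_index_ne _ _ (by decide),
        Struct.Assignment.update_self, hv]

theorem Formula.Separates.sat_or_swap {s : L.Srt} {φ : Formula L} (h : φ.Separates T s)
    {M : Struct L} {o : ∀ s, M.carrier s} {a b : M.carrier s}
    (hab : M.Sat (Struct.pairAssignment o a b) φ ∨ M.Sat (Struct.pairAssignment o b a) φ) :
    M.Sat (Struct.pairAssignment o a b) (.or φ (φ.swap s)) := by
  refine hab.imp_right fun hba => ?_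
  rw [Formula.sat_swap]
  refine (M.sat_congr φ fun t n hn => ?_).1 hba
  rcases h.freeVars hn with (e | e) | e
  · obtain ⟨rfl, rfl⟩ := Prod.mk.inj e
    rw [Struct.pairAssignment_one, Struct.Assignment.update_of_index_ne _ _ (by decide),
      Struct.Assignment.update_self, Struct.pairAssignment_two]
  · obtain ⟨rfl, rfl⟩ := Prod.mk.inj e
    rw [Struct.pairAssignment_two, Struct.Assignment.update_self, Struct.pairAssignment_one]
  · obtain rfl : n = 0 := e
    simp only [Struct.Assignment.update_of_index_ne _ _ (show (0 : ℕ) ≠ 1 by decide),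
      Struct.Assignment.update_of_index_ne _ _ (show (0 : ℕ) ≠ 2 by decide),
      Struct.Assignment.update_of_index_ne _ _ (show (0 : ℕ) ≠ 3 by decide),
      Struct.pairAssignment_of_ne _ _ _ (show (0 : ℕ) ≠ 1 by decide) (show (0 : ℕ) ≠ 2 by decide)]

/-- There is a common bound for all the tuples consisting of an element of a ball and of base
points. -/
theorem Struct.IsLocal.exists_bound {M : Struct L} (hM : M.IsLocal) (o : ∀ s, M.carrier s)
    (s : L.Srt) (d : L.Dist s) :
    ∃ B : Bound L, ∀ a : M.carrier s, M.dist d a (o s) → ∀ (X : Set (Var L)), ∀ β ∈ B.formulas X,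
      M.Sat (Struct.Assignment.update (fun t _ => o t) s 1 a) β := by
  -- Each coordinate stays at a distance from its base point that does not depend on `a`; all other
  -- distances follow by composition.
  have key : ∀ (t : L.Srt) (n : ℕ), ∃ e : L.Dist t, ∀ a : M.carrier s, M.dist d a (o s) →
      M.dist e (Struct.Assignment.update (fun t _ => o t) s 1 a t n) (o t) := by
    intro t n
    by_cases h : (t, n) = (s, 1)
    · obtain ⟨rfl, rfl⟩ := Prod.mk.inj h
      exact ⟨d, fun a ha => by rwa [Assignment.update_self]⟩
    · refine ⟨1, fun a _ => ?_⟩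
      rw [Assignment.update_of_ne _ _ h]
      exact (M.dist_one _ _).2 rfl
  choose e he using key
  have hc : ∀ t : L.Srt, ∃ f : L.Dist t, ∀ h : Nonempty (L.Const t),
      M.dist f (o t) (M.const h.some) := by
    intro t
    by_cases h : Nonempty (L.Const t)
    · obtain ⟨f, hf⟩ := hM.exists_dist (o t) (M.const h.some)
      exact ⟨f, fun _ => hf⟩
    · exact ⟨1, fun h' => absurd h' h⟩
  choose f hf using hc
  refine ⟨⟨fun t h _ => h.some, fun t n => e t n * f t, fun t n m => e t n * e t m⟩, ?_⟩
  rintro a ha X β (⟨t, h, n, -, rfl⟩ | ⟨t, n, m, -, -, rfl⟩)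
  · exact hM.comp _ _ _ _ _ (he t n a ha) (hf t h)
  · exact hM.comp _ _ _ _ _ (he t n a ha) (hM.symm _ _ _ (he t m a ha))

/-- In a local model of a local positively compact theory, a ball contains no infinite chain for a
separating formula. -/
theorem IsLocalPositivelyCompact.finite_of_sat (hT : IsLocalPositivelyCompact T) {M : Struct L}
    (hM : M.IsLocalModel T) (o : ∀ s, M.carrier s) {s : L.Srt} (d : L.Dist s) {φ : Formula L}
    (hφ : φ.Separates T s) {J : Type*} [LinearOrder J] (a : J → M.carrier s)
    (ha : ∀ i, M.dist d (a i) (o s))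
    (h : ∀ i j, i < j → M.Sat (Struct.pairAssignment o (a i) (a j)) φ) : Finite J := by
  by_contra hJ
  rw [not_finite_iff_infinite] at hJ
  have hψ := hφ.or_swap
  set ψ : Formula L := .or φ (φ.swap s) with hψdef
  -- The parameter tuple consists of the remaining free variables, which will be evaluated at base
  -- points.
  let z : List (Var L) := (ψ.freeVars_finite.subset
    (Set.sdiff_subset (s := ψ.freeVars) (t := {(s, 1), (s, 2)}))).toFinset.toList
  have hz : ∀ w, w ∈ z ↔ w ∈ ψ.freeVars \ {(s, 1), (s, 2)} := fun w => by simp [z]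
  have hz1 : (s, 1) ∉ z := fun h => ((hz _).1 h).2 (Or.inl rfl)
  have hz2 : (s, 2) ∉ z := fun h => ((hz _).1 h).2 (Or.inr rfl)
  obtain ⟨B, hB⟩ := hM.1.exists_bound o s d
  obtain ⟨k, -, hk⟩ := hT s 1 2 z (by decide) hz1 hz2 ψ hψ.isLocalPositive
    (fun w hw => by
      by_cases h : w ∈ ({(s, 1), (s, 2)} : Set (Var L))
      · exact Or.inl h
      · exact Or.inr ((hz w).2 ⟨hw, h⟩))
    -- Quantifying `z` leaves the two compared variables untouched, so a witness would satisfy the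
    -- formula with equal values.
    (fun N hN v hv => by
      obtain ⟨w, hw, e⟩ := Formula.exists_sat_of_sat_exs hv.1
      refine hψ.denial N hN w ?_ hw
      rw [e _ _ hz1, e _ _ hz2]
      exact (N.dist_one _ _).1 hv.2) B (d * d)
  obtain ⟨S, hS⟩ := Infinite.exists_subset_card_eq J k
  let g := S.orderEmbOfFin hS
  refine hk M hM ⟨fun p => a (g p), fun t _ => o t, fun p q hpq => ⟨fun β hβ => ?_, ?_, ?_⟩⟩
  · exact hB _ (ha _) _ β hβ
  · exact hM.1.comp _ _ _ _ _ (ha _) (hM.1.symm _ _ _ (ha _))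
  · refine hφ.sat_or_swap ?_
    rcases lt_or_gt_of_ne hpq with hlt | hlt
    · exact Or.inl (h _ _ (g.strictMono hlt))
    · exact Or.inr (h _ _ (g.strictMono hlt))

/-! ### A partition bound by end-homogeneous branches -/

section EndHomogeneous

variable {α F : Type u} [LinearOrder α] [WellFoundedLT α] (c : α → α → F)

/-- The branch of `a` in the tree of end-homogeneous sequences for the colouring `c`. -/
noncomputable def branch (a : α) : α → Prop :=
  WellFoundedLT.fix fun x ih => x < a ∧ ∀ (y : α) (h : y < x), ih y h → c y x = c y a

theorem branch_iff {a x : α} :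
    branch c a x ↔ x < a ∧ ∀ y, y < x → branch c a y → c y x = c y a := by
  rw [branch, WellFoundedLT.fix_eq]

variable {c}

/-- If all homogeneous chains of a colouring of pairs are finite, then the number of points is
bounded in terms of the number of colours. -/
theorem exists_injective_of_finite_homogeneous
    (h : ∀ (f : F) (S : Set α), (∀ x ∈ S, ∀ y ∈ S, x < y → c x y = f) → S.Finite) :
    ∃ code : α → Set ((F × ℕ) × (F × ℕ)), Function.Injective code := by
  -- Points of the branch of `a` with the same colour towards `a` form a homogeneous chain, hence a
  -- finite set that can be numbered. Colour and number together identify a point of the branch.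
  have hfin : ∀ (a : α) (f : F), ∃ n : α → ℕ, Set.InjOn n {x | branch c a x ∧ c x a = f} := by
    intro a f
    refine Set.countable_iff_exists_injOn.1 (h f _ ?_).countable
    rintro x ⟨hx, rfl⟩ y ⟨hy, e⟩ hxy
    exact ((branch_iff c).1 hy).2 x hxy hx
  choose n hn using hfin
  let idx : α → α → F × ℕ := fun a x => (c x a, n a (c x a) x)
  have hinj : ∀ a x y, branch c a x → branch c a y → idx a x = idx a y → x = y := by
    intro a x y hx hy e
    obtain ⟨e₁, e₂⟩ := Prod.mk.inj e
    rw [e₁] at e₂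
    exact hn a _ ⟨hx, e₁⟩ ⟨hy, rfl⟩ e₂
  -- The code records the labels occurring on the branch together with their order; diagonal pairs
  -- record the labels themselves.
  let code : α → Set ((F × ℕ) × (F × ℕ)) := fun a =>
    {p | ∃ x y, branch c a x ∧ branch c a y ∧ x ≤ y ∧ p = (idx a x, idx a y)}
  have hcode : ∀ a a', code a = code a' → ∀ x y, branch c a x → branch c a y → x ≤ y →
      ∃ x' y', branch c a' x' ∧ branch c a' y' ∧ x' ≤ y' ∧ idx a x = idx a' x' ∧
        idx a y = idx a' y' := by
    intro a a' e x y hx hy hxy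
    have hm : (idx a x, idx a y) ∈ code a := ⟨x, y, hx, hy, hxy, rfl⟩
    rw [e] at hm
    obtain ⟨x', y', hx', hy', hxy', e'⟩ := hm
    exact ⟨x', y', hx', hy', hxy', (Prod.mk.inj e').1, (Prod.mk.inj e').2⟩
  -- Induction step: equal codes force equal labelled branches. The point `x'` of the other branch
  -- with the label of `x` cannot be earlier, by agreement below `x`.
  have step : ∀ a a', code a = code a' → ∀ x,
      (∀ y < x, (branch c a y → branch c a' y ∧ idx a y = idx a' y) ∧
        (branch c a' y → branch c a y ∧ idx a' y = idx a y)) →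
      branch c a x → branch c a' x ∧ idx a x = idx a' x := by
    intro a a' e x ih hx
    obtain ⟨x', -, hx', -, -, ex, -⟩ := hcode a a' e x x hx hx le_rfl
    rcases lt_trichotomy x' x with hlt | rfl | hlt
    · obtain ⟨h₁, h₂⟩ := (ih x' hlt).2 hx'
      exact absurd (hinj a _ _ h₁ hx (h₂.symm.trans ex.symm)) hlt.ne
    · exact ⟨hx', ex⟩
    -- If `x'` came later, `x` would also lie on the branch of `a'`, and the coded pair `(x, x')`
    -- would pull back to a pair ending at `x`. Its first entry can be neither `x` nor earlier.
    · have hx'' : branch c a' x := by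
        refine (branch_iff c).2 ⟨hlt.trans ((branch_iff c).1 hx').1, fun y hy hy' => ?_⟩
        obtain ⟨h₁, h₂⟩ := (ih y hy).2 hy'
        rw [((branch_iff c).1 hx).2 y hy h₁]
        exact (Prod.mk.inj h₂).1.symm
      obtain ⟨u, w, hu, hw, huw, eu, ew⟩ := hcode a' a e.symm x x' hx'' hx' hlt.le
      obtain rfl : w = x := hinj a _ _ hw hx (ew.symm.trans ex.symm)
      rcases huw.lt_or_eq with hlt' | rfl
      · obtain ⟨h₁, h₂⟩ := (ih u hlt').1 hu
        exact absurd (hinj a' _ _ h₁ hx'' (h₂.symm.trans eu.symm)) hlt'.ne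
      · exact absurd (hinj a' _ _ hx'' hx' (eu.trans ex)) hlt.ne
  have all : ∀ a a', code a = code a' → ∀ x,
      (branch c a x → branch c a' x ∧ idx a x = idx a' x) ∧
        (branch c a' x → branch c a x ∧ idx a' x = idx a x) := by
    intro a a' e x
    induction x using WellFoundedLT.induction with
    | ind x ih => exact ⟨step a a' e x ih, step a' a e.symm x fun y hy => (ih y hy).symm⟩
  have main : ∀ a a', code a = code a' → ¬ a < a' := by
    intro a a' e hlt
    -- With common branches and labels, `a` meets the condition for the branch of `a'`, hence would
    -- lie on its own branch.
    have ha : branch c a' a := by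
      refine (branch_iff c).2 ⟨hlt, fun y _ hy' => ?_⟩
      exact (Prod.mk.inj ((all a a' e y).2 hy').2).1.symm
    exact ((branch_iff c).1 ((all a a' e a).2 ha).1).1.false
  refine ⟨code, fun a a' e => ?_⟩
  rcases lt_trichotomy a a' with hlt | rfl | hlt
  · exact absurd hlt (main _ _ e)
  · rfl
  · exact absurd hlt (main _ _ e.symm)

end EndHomogeneous

/-! ### Bounding atomically closed models -/

/-- A type bounding the size of the sort `s` of atomically closed models. -/
abbrev SizeBound (L : LocalLanguage.{u}) (s : L.Srt) : Type u :=
  L.Dist s × Set ((Formula L × ℕ) × (Formula L × ℕ))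

/-- The size of atomically closed models of a local positively compact theory is bounded. -/
theorem IsAtomicallyClosed.exists_injective_sizeBound (hT : IsNegativeLocalTheory T)
    (hcomp : IsLocalPositivelyCompact T) {N : Struct L} (hN : IsAtomicallyClosed T N)
    (s : L.Srt) : ∃ f : N.carrier s → SizeBound L s, Function.Injective f := by
  have o : ∀ t, N.carrier t := fun t => (N.nonempty t).some
  have hball : ∀ d : L.Dist s, ∃ code : {a : N.carrier s // N.dist d a (o s)} →
      Set ((Formula L × ℕ) × (Formula L × ℕ)), Function.Injective code := by
    intro d
    obtain ⟨_, _⟩ := exists_wellFoundedLT {a : N.carrier s // N.dist d a (o s)}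
    have hc : ∀ x y : {a : N.carrier s // N.dist d a (o s)}, ∃ φ : Formula L, x ≠ y →
        φ.Separates T s ∧ N.Sat (Struct.pairAssignment o x.1 y.1) φ := by
      intro x y
      by_cases hxy : x = y
      -- The colour on the diagonal is irrelevant.
      · exact ⟨.top, fun h => absurd hxy h⟩
      · obtain ⟨φ, hφ⟩ := hN.exists_separates hT o fun e => hxy (Subtype.ext e)
        exact ⟨φ, fun _ => hφ⟩
    choose c hc using hc
    refine exists_injective_of_finite_homogeneous (c := c) fun φ S hS => ?_
    by_cases hφ : φ.Separates T s
    · exact hcomp.finite_of_sat hN.1 o d hφ (fun x : S => x.1.1) (fun x => x.1.2)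
        fun x y hxy => by
          rw [← hS x.1 x.2 y.1 y.2 hxy]
          exact (hc _ _ (ne_of_lt hxy)).2
    -- A colour that does not separate is never taken by distinct points.
    · refine Set.Subsingleton.finite fun x hx y hy => ?_
      by_contra hxy
      rcases lt_or_gt_of_ne hxy with hlt | hlt
      · exact hφ (hS x hx y hy hlt ▸ (hc _ _ hlt.ne).1)
      · exact hφ (hS y hy x hx hlt ▸ (hc _ _ hlt.ne).1)
  choose code hcode using hball
  choose d hd using fun a : N.carrier s => hN.1.1.exists_dist a (o s)
  refine ⟨fun a => (d a, code (d a) ⟨a, hd a⟩), fun a b e => ?_⟩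
  obtain ⟨e₁, e₂⟩ := Prod.mk.inj e
  -- The codes belong to balls depending on the chosen distance; equal distances put both points in
  -- the same ball.
  have key : ∀ d' (e : d b = d'), code (d b) ⟨b, hd b⟩ = code d' ⟨b, e ▸ hd b⟩ := by
    rintro _ rfl
    rfl
  rw [key _ e₁.symm] at e₂
  exact congrArg Subtype.val (hcode _ e₂)

/-! ### Retractors from maximal atomically closed models -/

/-- An atomically closed model whose elements belong to given sets `X s`. -/
structure NamedModel (T : Set (Formula L)) (X : L.Srt → Type u) where
  obj : Struct L
  isAtomicallyClosed : IsAtomicallyClosed T obj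
  name : ∀ s, obj.carrier s → X s
  inj : ∀ s, Function.Injective (name s)

namespace NamedModel

variable {X : L.Srt → Type u}

instance : Preorder (NamedModel T X) where
  le A B := ∃ h : Hom A.obj B.obj, ∀ s a, B.name s (h.toFun s a) = A.name s a
  le_refl A := ⟨Hom.id _, fun _ _ => rfl⟩
  le_trans A B C := by
    rintro ⟨f, hf⟩ ⟨g, hg⟩
    exact ⟨g.comp f, fun s a => by rw [← hf, ← hg]; rfl⟩

/-- The homomorphism witnessing an inequality of named models. -/
noncomputable def homOfLE {A B : NamedModel T X} (h : A ≤ B) : Hom A.obj B.obj := h.choose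

theorem name_homOfLE {A B : NamedModel T X} (h : A ≤ B) (s : L.Srt) (a : A.obj.carrier s) :
    B.name s ((homOfLE h).toFun s a) = A.name s a := h.choose_spec s a

/-- The diagram of a set of named models. -/
noncomputable def diagram (c : Set (NamedModel T X)) : Diagram L c where
  obj A := A.1.obj
  map h := homOfLE h
  map_map {_ j k} hij hjk s a := k.1.inj s <|
    (name_homOfLE (B := k.1) hjk s _).trans <|
      (name_homOfLE (B := j.1) hij s a).trans (name_homOfLE (B := k.1) (hij.trans hjk) s a).symm

/-- The set of names used in a member of `c`. -/
def setColimit (c : Set (NamedModel T X)) : (diagram c).SetColimit where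
  carrier s := {x : X s // ∃ A : c, ∃ a, A.1.name s a = x}
  incl A s a := ⟨A.1.name s a, A, a, rfl⟩
  incl_map h s a := Subtype.ext (name_homOfLE h s a)
  surj s x := by
    obtain ⟨_, A, a, rfl⟩ := x
    exact ⟨A, a, rfl⟩
  exists_eq {A s a b} h := by
    obtain rfl : a = b := A.1.inj s (congrArg Subtype.val h)
    exact ⟨A, le_rfl, rfl⟩

/-- The colimit is carried by the union of the name sets. It remains atomically closed because a
failure to be an embedding would already show at some stage. -/
theorem bddAbove (hT : IsNegativeLocalTheory T) (c : Set (NamedModel T X)) [IsDirectedOrder c]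
    [Nonempty c] : BddAbove c := by
  let C := setColimit c
  refine ⟨⟨C.struct, ⟨C.isLocalModel hT fun A => A.1.isAtomicallyClosed.1, fun N hN f =>
    C.isEmbedding f fun A => A.1.isAtomicallyClosed.2 N hN _⟩, fun s x => x.1,
    fun s => Subtype.val_injective⟩, ?_⟩
  intro A hA
  exact ⟨C.inclHom ⟨A, hA⟩, fun s a => rfl⟩

end NamedModel

/-- If all homomorphisms from `R` to atomically closed models are surjective, then `R` is a
retractor. -/
theorem IsAtomicallyClosed.isRetractor (hT : IsNegativeLocalTheory T) {R : Struct L}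
    (hR : IsAtomicallyClosed T R)
    (h : ∀ N : Struct L, IsAtomicallyClosed T N → ∀ f : Hom R N, ∀ s,
      Function.Surjective (f.toFun s)) : IsRetractor T R := by
  refine ⟨hR.1, fun N hN f => ?_⟩
  obtain ⟨K, hK, ⟨q⟩⟩ := exists_hom_isAtomicallyClosed hT hN
  obtain ⟨g, hg⟩ := (hR.2 K hK.1 (q.comp f)).exists_inverse (h K hK (q.comp f))
  exact ⟨g.comp q, hg⟩

/-- Serves to name a larger model compatibly with a smaller one. As `e` takes at most `|Y| < |X|`
values, its complement has room for all points outside the range of `q`. -/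
theorem exists_extension_injective {α β Y X : Type u} [Infinite Y] {q : α → β}
    (hq : Function.Injective q) {e : α → X} (he : Function.Injective e) {f : β → Y}
    (hf : Function.Injective f) (hYX : Cardinal.mk Y < Cardinal.mk X) :
    ∃ e' : β → X, Function.Injective e' ∧ (∀ a, e' (q a) = e a) ∧
      ∀ b, e' b ∈ Set.range e → b ∈ Set.range q := by
  classical
  have hαY : Cardinal.mk (Set.range e) ≤ Cardinal.mk Y :=
    Cardinal.mk_range_le.trans (Cardinal.mk_le_of_injective (hf.comp hq))
  have : Infinite X := Cardinal.infinite_iff.2 ((Cardinal.infinite_iff.1 ‹_›).trans hYX.le)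
  have hcompl : Cardinal.mk Y ≤ Cardinal.mk ↑(Set.range e)ᶜ := by
    rw [Cardinal.mk_compl_of_infinite _ (hαY.trans_lt hYX)]
    exact hYX.le
  obtain ⟨j⟩ := hcompl
  let e' : β → X := fun b => if h : b ∈ Set.range q then e h.choose else (j (f b)).1
  have h₁ : ∀ a, e' (q a) = e a := fun a => by
    have h : q a ∈ Set.range q := ⟨a, rfl⟩
    simp only [e', dif_pos h]
    rw [hq h.choose_spec]
  have h₂ : ∀ b, b ∉ Set.range q → e' b = (j (f b)).1 := fun b h => dif_neg h
  have h₃ : ∀ b, e' b ∈ Set.range e → b ∈ Set.range q := fun b hb => by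
    by_contra h
    rw [h₂ b h] at hb
    exact (j (f b)).2 hb
  refine ⟨e', fun b b' hbb => ?_, h₁, h₃⟩
  by_cases hb : b ∈ Set.range q
  · have hb' : b' ∈ Set.range q := h₃ b' (by
      obtain ⟨a, rfl⟩ := hb
      exact ⟨a, by rw [← hbb, h₁]⟩)
    obtain ⟨a, rfl⟩ := hb
    obtain ⟨a', rfl⟩ := hb'
    rw [h₁, h₁] at hbb
    rw [he hbb]
  · have hb' : b' ∉ Set.range q := fun hb' => hb (h₃ b (by
      obtain ⟨a, rfl⟩ := hb'
      exact ⟨a, by rw [hbb, h₁]⟩))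
    rw [h₂ b hb, h₂ b' hb'] at hbb
    exact hf (j.injective (Subtype.ext hbb))

/-- A local positively compact theory has retractors. -/
theorem IsLocalPositivelyCompact.hasRetractors (hT : IsNegativeLocalTheory T)
    (hcomp : IsLocalPositivelyCompact T) : HasRetractors T := by
  intro M hM
  obtain ⟨K, hK, ⟨q⟩⟩ := exists_hom_isAtomicallyClosed hT hM
  choose f hf using hK.exists_injective_sizeBound hT hcomp
  -- Names are taken from the power set of the size bound: by Cantor, fresh names never run out for
  -- models of bounded size.
  let K' : NamedModel T fun s => Set (SizeBound L s) :=
    ⟨K, hK, fun s a => {f s a}, fun s => Set.singleton_injective.comp (hf s)⟩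
  obtain ⟨R, ⟨g, -⟩, hR⟩ := zorn_le_nonempty_Ici₀ K' (fun c _ hc y hy => by
    have : Nonempty c := ⟨⟨y, hy⟩⟩
    have : IsDirectedOrder c := ⟨hc.directedOn.directed_val⟩
    exact NamedModel.bddAbove hT c) K' le_rfl
  refine ⟨R.obj, R.isAtomicallyClosed.isRetractor hT fun N hN h => ?_, R.obj,
    R.isAtomicallyClosed.1, ⟨g.comp q⟩, ⟨Hom.id _⟩⟩
  choose k hk using hN.exists_injective_sizeBound hT hcomp
  have : Nonempty (Formula L) := ⟨.top⟩
  have hinf : ∀ s, Infinite (SizeBound L s) := fun s => inferInstance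
  choose e he₁ he₂ he₃ using fun s => exists_extension_injective
    ((R.isAtomicallyClosed.2 N hN.1 h).injective s) (R.inj s) (hk s)
    (by rw [Cardinal.mk_set]; exact Cardinal.cantor _)
  -- Maximality of `R` makes every name used in `N` a name used in `R`. Points outside the image of
  -- `h` received fresh names, so there are none.
  obtain ⟨r, hr⟩ := hR (b := ⟨N, hN, e, he₁⟩) ⟨h, he₂⟩
  exact fun s b => he₃ s b ⟨_, hr s b⟩

open Cardinal

/-! ### Counting formulas -/

section Cardinality

theorem mk_sigma_le_of_le {κ : Cardinal.{u}} (hκ : ℵ₀ ≤ κ) {ι : Type u} {f : ι → Type u}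
    (hι : #ι ≤ κ) (hf : ∀ i, #(f i) ≤ κ) : #(Σ i, f i) ≤ κ := by
  rw [mk_sigma]
  exact (sum_le_mk_mul_iSup _).trans
    ((mul_le_mul' hι (ciSup_le' hf)).trans (mul_eq_self hκ).le)

theorem mk_sum_le_of_le {κ : Cardinal.{u}} (hκ : ℵ₀ ≤ κ) {α β : Type u} (hα : #α ≤ κ)
    (hβ : #β ≤ κ) : #(α ⊕ β) ≤ κ := by
  rw [mk_sum, lift_id, lift_id]
  exact add_le_of_le hκ hα hβ

theorem mk_prod_le_of_le {κ : Cardinal.{u}} (hκ : ℵ₀ ≤ κ) {α β : Type u} (hα : #α ≤ κ)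
    (hβ : #β ≤ κ) : #(α × β) ≤ κ := by
  rw [mk_prod, lift_id, lift_id]
  exact mul_le_of_le hκ hα hβ

theorem mk_fin_arrow_le_of_le {κ : Cardinal.{u}} (hκ : ℵ₀ ≤ κ) {α : Type u} (hα : #α ≤ κ)
    (n : ℕ) : #(Fin n → α) ≤ κ := by
  rw [mk_arrow, lift_uzero, mk_fin, lift_natCast]
  exact (power_le_power_right hα).trans (power_nat_le hκ)

variable (L)

theorem LocalLanguage.aleph0_le_card : ℵ₀ ≤ L.card := le_max_left _ _

theorem LocalLanguage.mk_const_le_card : #(Σ s, L.Const s) ≤ L.card :=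
  (le_self_add.trans le_self_add).trans (le_max_right _ _)

theorem LocalLanguage.mk_rel_le_card : #L.Rel ≤ L.card :=
  ((self_le_add_left _ _).trans le_self_add).trans (le_max_right _ _)

theorem LocalLanguage.mk_dist_le_card : #(Σ s, L.Dist s) ≤ L.card :=
  (self_le_add_left _ _).trans (le_max_right _ _)

theorem LocalLanguage.mk_srt_le_card : #L.Srt ≤ L.card :=
  (mk_le_of_injective (f := fun s => (⟨s, 1⟩ : Σ s, L.Dist s)) fun _ _ h =>
    congrArg Sigma.fst h).trans L.mk_dist_le_card

theorem LocalLanguage.mk_var_le_card : #(Var L) ≤ L.card := by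
  rw [mk_prod, lift_uzero, mk_nat, lift_aleph0]
  exact mul_le_of_le L.aleph0_le_card L.mk_srt_le_card L.aleph0_le_card

theorem LocalLanguage.mk_term_le_card : #(Σ s, Term L s) ≤ L.card := by
  refine (mk_le_of_surjective (f := fun x : Var L ⊕ Σ s, L.Const s =>
    (Sum.elim (fun w => ⟨w.1, .var w.2⟩) (fun c => ⟨c.1, .const c.2⟩) x : Σ s, Term L s)) ?_).trans
    (mk_sum_le_of_le L.aleph0_le_card L.mk_var_le_card L.mk_const_le_card)
  rintro ⟨s, n | c⟩
  · exact ⟨Sum.inl (s, n), rfl⟩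
  · exact ⟨Sum.inr ⟨s, c⟩, rfl⟩

/-- The possible roots of the syntax tree of a formula. -/
inductive FormulaRoot : Type u
  | top | bot | neg | and | or
  | rel (R : L.Rel) (t : ∀ i, Term L (L.relSort R i))
  | dist (s : L.Srt) (d : L.Dist s) (t₁ t₂ : Term L s)
  | ex (w : Var L)

variable {L}

/-- The number of immediate subformulas. -/
def FormulaRoot.arity : FormulaRoot L → ℕ
  | .top | .bot | .rel _ _ | .dist _ _ _ _ => 0
  | .neg | .ex _ => 1
  | .and | .or => 2

/-- The formula with a given root and given immediate subformulas. -/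
def FormulaRoot.build : (r : FormulaRoot L) → (Fin r.arity → Formula L) → Formula L
  | .top, _ => .top
  | .bot, _ => .bot
  | .rel R t, _ => .rel R t
  | .dist _ d t₁ t₂, _ => .dist d t₁ t₂
  | .neg, f => .neg (f (0 : Fin 1))
  | .ex w, f => .ex w.1 w.2 (f (0 : Fin 1))
  | .and, f => .and (f (0 : Fin 2)) (f (1 : Fin 2))
  | .or, f => .or (f (0 : Fin 2)) (f (1 : Fin 2))

/-- Formulas are covered by a finitely branching `WType`, whose cardinality is controlled by the
number of roots. -/
theorem FormulaRoot.elim_surjective : Function.Surjective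
    (WType.elim (β := fun r : FormulaRoot L => Fin r.arity) (Formula L) fun x =>
      x.1.build x.2) := by
  intro φ
  induction φ with
  | top => exact ⟨.mk .top Fin.elim0, rfl⟩
  | bot => exact ⟨.mk .bot Fin.elim0, rfl⟩
  | rel R t => exact ⟨.mk (.rel R t) Fin.elim0, rfl⟩
  | dist d t₁ t₂ => exact ⟨.mk (.dist _ d t₁ t₂) Fin.elim0, rfl⟩
  | neg φ ih =>
    obtain ⟨x, rfl⟩ := ih
    exact ⟨.mk .neg fun _ => x, rfl⟩
  | ex s n φ ih =>
    obtain ⟨x, rfl⟩ := ih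
    exact ⟨.mk (.ex (s, n)) fun _ => x, rfl⟩
  | and φ ψ ih₁ ih₂ =>
    obtain ⟨x, rfl⟩ := ih₁
    obtain ⟨y, rfl⟩ := ih₂
    exact ⟨.mk .and (![x, y] : Fin 2 → _), rfl⟩
  | or φ ψ ih₁ ih₂ =>
    obtain ⟨x, rfl⟩ := ih₁
    obtain ⟨y, rfl⟩ := ih₂
    exact ⟨.mk .or (![x, y] : Fin 2 → _), rfl⟩

variable (L)

theorem LocalLanguage.mk_formulaRoot_le_card : #(FormulaRoot L) ≤ L.card := by
  have hκ := L.aleph0_le_card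
  let A := Σ R, ∀ i, Term L (L.relSort R i)
  let B := Σ s, L.Dist s × Term L s × Term L s
  have hterm : ∀ s, #(Term L s) ≤ L.card := fun s =>
    (mk_le_of_injective (sigma_mk_injective (i := s))).trans L.mk_term_le_card
  have hdist : ∀ s, #(L.Dist s) ≤ L.card := fun s =>
    (mk_le_of_injective (sigma_mk_injective (i := s))).trans L.mk_dist_le_card
  have hA : #A ≤ L.card := mk_sigma_le_of_le hκ L.mk_rel_le_card fun R =>
    (mk_le_of_injective (f := fun (t : ∀ i, Term L (L.relSort R i)) i =>
      (⟨_, t i⟩ : Σ s, Term L s)) fun t t' h => funext fun i =>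
        eq_of_heq (Sigma.mk.inj (congrFun h i)).2).trans
      (mk_fin_arrow_le_of_le hκ L.mk_term_le_card _)
  have hB : #B ≤ L.card := mk_sigma_le_of_le hκ L.mk_srt_le_card fun s =>
    mk_prod_le_of_le hκ (hdist s) (mk_prod_le_of_le hκ (hterm s) (hterm s))
  have h5 : #(ULift.{u} (Fin 5)) ≤ L.card := (mk_le_aleph0).trans hκ
  let f : (A ⊕ B) ⊕ (Var L ⊕ ULift.{u} (Fin 5)) → FormulaRoot L := Sum.elim
    (Sum.elim (fun x => .rel x.1 x.2) fun x => .dist x.1 x.2.1 x.2.2.1 x.2.2.2)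
    (Sum.elim .ex fun n => ![.top, .bot, .neg, .and, .or] n.down)
  refine (mk_le_of_surjective (f := f) ?_).trans
    (mk_sum_le_of_le hκ (mk_sum_le_of_le hκ hA hB) (mk_sum_le_of_le hκ L.mk_var_le_card h5))
  rintro (_ | _ | _ | _ | _ | ⟨R, t⟩ | ⟨s, d, t₁, t₂⟩ | w)
  · exact ⟨.inr (.inr ⟨0⟩), rfl⟩
  · exact ⟨.inr (.inr ⟨1⟩), rfl⟩
  · exact ⟨.inr (.inr ⟨2⟩), rfl⟩
  · exact ⟨.inr (.inr ⟨3⟩), rfl⟩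
  · exact ⟨.inr (.inr ⟨4⟩), rfl⟩
  · exact ⟨.inl (.inl ⟨R, t⟩), rfl⟩
  · exact ⟨.inl (.inr ⟨s, d, t₁, t₂⟩), rfl⟩
  · exact ⟨.inr (.inl w), rfl⟩

/-- There are at most `|L|` formulas. -/
theorem LocalLanguage.mk_formula_le_card : #(Formula L) ≤ L.card := by
  refine (mk_le_of_surjective FormulaRoot.elim_surjective).trans
    (WType.cardinalMk_le_max_aleph0_of_finite'.trans (max_le ?_ L.aleph0_le_card))
  rw [lift_uzero]
  exact L.mk_formulaRoot_le_card

end Cardinality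

/-! ### Downward Löwenheim-Skolem by Skolem functions -/

section LowenheimSkolem

/-- The language with a function symbol for each existential quantifier `∃ (s, n), φ` and each
finite list of variables. -/
def skolemLanguage (L : LocalLanguage.{u}) : FirstOrder.Language.{u, 0} where
  Functions n := (Var L × Formula L) × (Fin n → Var L)
  Relations _ := Empty

/-- `b` is a witness for `∃ w, φ` when the variables `x i` have the values `a i`. -/
def IsWitness (N : Struct L) {n : ℕ} (w : Var L) (φ : Formula L) (x : Fin n → Var L)
    (a : Fin n → Σ s, N.carrier s) (b : N.carrier w.1) : Prop :=
  ∃ v : N.Assignment, (∀ i, (⟨_, v (x i).1 (x i).2⟩ : Σ s, N.carrier s) = a i) ∧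
    N.Sat (v.update w.1 w.2 b) φ

open Classical in
/-- The interpretation of the function symbols of `skolemLanguage` by witnesses. -/
noncomputable instance skolemStructure (N : Struct L) :
    (skolemLanguage L).Structure (Σ s, N.carrier s) where
  funMap f a := ⟨f.1.1.1, if h : ∃ b, IsWitness N f.1.1 f.1.2 f.2 a b then h.choose else
    (N.nonempty f.1.1.1).some⟩
  RelMap r := r.elim

theorem exists_isWitness_mem (N : Struct L) (H : (skolemLanguage L).Substructure (Σ s, N.carrier s))
    {n : ℕ} (w : Var L) (φ : Formula L) (x : Fin n → Var L) (a : Fin n → Σ s, N.carrier s)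
    (ha : ∀ i, a i ∈ H) (h : ∃ b, IsWitness N w φ x a b) :
    ∃ b, IsWitness N w φ x a b ∧ (⟨w.1, b⟩ : Σ s, N.carrier s) ∈ H := by
  refine ⟨h.choose, h.choose_spec, ?_⟩
  have := H.fun_mem (n := n) ((w, φ), x) a ha
  simp only [FirstOrder.Language.Structure.funMap, dif_pos h] at this
  exact this

/-- The downward Löwenheim-Skolem theorem. -/
theorem Struct.exists_elementary (N : Struct L) (S : Set (Σ s, N.carrier s)) (hS : #S ≤ L.card) :
    ∃ (B : Struct L) (i : Hom B N),
      (∀ (φ : Formula L) (v : B.Assignment), B.Sat v φ ↔ N.Sat (i.mapAssignment v) φ) ∧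
      (∀ p ∈ S, ∃ b, i.toFun p.1 b = p.2) ∧ B.card ≤ L.card := by
  -- The sorts are merged into one total space, so that the cardinality bound for closures in a
  -- one-sorted language applies.
  let H := FirstOrder.Language.Substructure.closure (skolemLanguage L) S
  have hκ := L.aleph0_le_card
  have hfun : #(Σ n, (skolemLanguage L).Functions n) ≤ L.card := by
    have : #(Σ n : ULift.{u} ℕ, (skolemLanguage L).Functions n.down) ≤ L.card :=
      mk_sigma_le_of_le hκ (mk_le_aleph0.trans hκ) fun n =>
        mk_prod_le_of_le hκ (mk_prod_le_of_le hκ L.mk_var_le_card L.mk_formula_le_card)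
          (mk_fin_arrow_le_of_le hκ L.mk_var_le_card _)
    exact (mk_le_of_surjective (f := fun p : Σ n : ULift.{u} ℕ, (skolemLanguage L).Functions n.down =>
      (⟨p.1.down, p.2⟩ : Σ n, (skolemLanguage L).Functions n))
      fun p => ⟨⟨⟨p.1⟩, p.2⟩, rfl⟩).trans this
  have hH : #H ≤ L.card := by
    have := FirstOrder.Language.Substructure.lift_card_closure_le (L := skolemLanguage L) (s := S)
    rw [lift_id, lift_id, lift_id] at this
    exact this.trans (max_le hκ (add_le_of_le hκ hS hfun))
  have v₀ : N.Assignment := fun s _ => (N.nonempty s).some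
  let C : ∀ s, Set (N.carrier s) := fun s => {a | (⟨s, a⟩ : Σ s, N.carrier s) ∈ H}
  have hne : ∀ s, (C s).Nonempty := fun s => by
    obtain ⟨b, -, hb⟩ := exists_isWitness_mem N H (n := 0) (s, 0) .top Fin.elim0 Fin.elim0
      (fun i => i.elim0) ⟨v₀ s 0, v₀, fun i => i.elim0, trivial⟩
    exact ⟨b, hb⟩
  have hc : ∀ {s : L.Srt} (c : L.Const s), N.const c ∈ C s := by
    intro s c
    obtain ⟨b, ⟨v, -, hv⟩, hb⟩ := exists_isWitness_mem N H (n := 0) (s, 0)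
      (.dist 1 (.var (s := s) 0) (.const c)) Fin.elim0 Fin.elim0
      (fun i => i.elim0) ⟨N.const c, v₀, fun i => i.elim0, by
        simp [Sat, eval, N.dist_one, Assignment.update_self]⟩
    simp only [Sat, eval, N.dist_one, Assignment.update_self] at hv
    rw [← hv]
    exact hb
  let i := N.inclusion C hne hc
  refine ⟨N.restrict C hne hc, i, fun φ => ?_, fun p hp =>
    ⟨⟨p.2, FirstOrder.Language.Substructure.subset_closure hp⟩, rfl⟩, ?_⟩
  · induction φ with
    | top => exact fun _ => Iff.rfl
    | bot => exact fun _ => Iff.rfl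
    | rel R t =>
      intro v
      simp only [Sat, Hom.eval_mapAssignment]
      exact Iff.rfl
    | dist d t₁ t₂ =>
      intro v
      simp only [Sat, Hom.eval_mapAssignment]
      exact Iff.rfl
    | neg φ ih => exact fun v => not_congr (ih v)
    | and φ ψ ih₁ ih₂ => exact fun v => and_congr (ih₁ v) (ih₂ v)
    | or φ ψ ih₁ ih₂ => exact fun v => or_congr (ih₁ v) (ih₂ v)
    | ex s n φ ih =>
      intro v
      constructor
      · rintro ⟨b, hb⟩
        exact ⟨b.1, i.mapAssignment_update v s n b ▸ (ih _).1 hb⟩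
      · rintro ⟨b, hb⟩
        -- The free variables of `φ` serve as arguments of the Skolem function. The new witness need
        -- only agree with the old assignment on them, away from `(s, n)`.
        obtain ⟨k, x, hx⟩ : ∃ (k : ℕ) (x : Fin k → Var L), ∀ w ∈ φ.freeVars, ∃ r, x r = w := by
          refine ⟨_, φ.freeVars_finite.toFinset.toList.get, fun w hw => ?_⟩
          exact List.mem_iff_get.1 (by simpa using hw)
        obtain ⟨b', ⟨v', hv', hb'⟩, hmem⟩ := exists_isWitness_mem N H (s, n) φ x
          (fun r => ⟨_, i.mapAssignment v (x r).1 (x r).2⟩) (fun r => (v _ _).2)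
          ⟨b, i.mapAssignment v, fun _ => rfl, hb⟩
        let b'' : (N.restrict C hne hc).carrier s := ⟨b', hmem⟩
        refine ⟨b'', (ih _).2 ?_⟩
        rw [i.mapAssignment_update v s n b'']
        refine (N.sat_congr φ fun t m hm => ?_).1 hb'
        obtain ⟨r, hr⟩ := hx _ hm
        refine Assignment.update_congr _ fun _ => ?_
        have := eq_of_heq (Sigma.mk.inj (hv' r)).2
        rwa [hr] at this
  · refine (mk_le_of_injective (f := fun p : Σ s, (N.restrict C hne hc).carrier s =>
      (⟨⟨p.1, p.2.1⟩, p.2.2⟩ : H)) ?_).trans hH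
    rintro ⟨s, a, ha⟩ ⟨t, b, hb⟩ h
    obtain ⟨rfl, h⟩ := Sigma.mk.inj (congrArg Subtype.val h)
    obtain rfl := eq_of_heq h
    rfl

end LowenheimSkolem

/-! ### Ultrahomogeneous models -/

theorem Hom.mapAssignment_pairAssignment {M N : Struct L} (f : Hom M N) (o : ∀ s, M.carrier s)
    {s : L.Srt} (a b : M.carrier s) : f.mapAssignment (Struct.pairAssignment o a b) =
      Struct.pairAssignment (fun t => f.toFun t (o t)) (f.toFun s a) (f.toFun s b) := by
  rw [Struct.pairAssignment, Hom.mapAssignment_update, Hom.mapAssignment_update]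
  rfl

/-- In an ultrahomogeneous model one can realize the positive type, over a small set, of an element
of an extension. -/
theorem IsUltrahomogeneous.exists_realization {R K : Struct L}
    (hR : IsUltrahomogeneous (Order.succ L.card) T R) (hK : K.IsLocalModel T) (f : Hom R K)
    (o : ∀ t, R.carrier t) {s : L.Srt} (b : K.carrier s) (S : Set (R.carrier s))
    (hS : #S ≤ L.card) :
    ∃ a : R.carrier s,
      (∀ d : L.Dist s, K.dist d b (f.toFun s (o s)) → R.dist d a (o s)) ∧
      ∀ φ : Formula L, φ.IsPositive → ∀ x ∈ S,
        K.Sat (Struct.pairAssignment (fun t => f.toFun t (o t)) (f.toFun s x) b) φ →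
          R.Sat (Struct.pairAssignment o x a) φ := by
  have hκ := L.aleph0_le_card
  -- A small elementary `A` in `R` contains `S` and the base points; a small elementary `B` in `K`
  -- contains `b` and the image of `A`. Ultrahomogeneity maps `B` to `R` over `A`, and the image of
  -- `b` is the required element.
  obtain ⟨A, i, hi, hiS, hA⟩ := R.exists_elementary
    (Sigma.mk s '' S ∪ Set.range fun t => (⟨t, o t⟩ : Σ t, R.carrier t))
    ((mk_union_le _ _).trans (add_le_of_le hκ (mk_image_le.trans hS)
      (mk_range_le.trans L.mk_srt_le_card)))
  obtain ⟨B, j, hj, hjS, hB⟩ := K.exists_elementary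
    ({⟨s, b⟩} ∪ Set.range fun p : Σ t, A.carrier t =>
      (⟨p.1, f.toFun _ (i.toFun _ p.2)⟩ : Σ t, K.carrier t))
    ((mk_union_le _ _).trans (add_le_of_le hκ ((mk_singleton _).le.trans (one_le_aleph0.trans hκ))
      (mk_range_le.trans hA)))
  have hj' : j.IsEmbedding :=
    Hom.IsPositiveEmbedding.isEmbedding fun φ _ v hv => (hj φ v).2 hv
  have hBT : B.IsLocalModel T := ⟨hj'.isLocal hK.1, fun φ hφ v => (hj φ v).2 (hK.2 φ hφ _)⟩
  choose g hg using fun (t : L.Srt) (x : A.carrier t) =>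
    hjS ⟨t, f.toFun t (i.toFun t x)⟩ (Or.inr ⟨⟨t, x⟩, rfl⟩)
  simp only at hg
  let G : Hom A B :=
    { toFun := g
      map_const := fun c => hj'.injective _ (by
        rw [hg, i.map_const, f.map_const, j.map_const])
      map_rel := fun Q a ha => hj'.rel Q _ (by
        simp only [hg]
        exact f.map_rel Q _ (i.map_rel Q a ha))
      map_dist := fun d a a' ha => hj'.dist d _ _ (by
        rw [hg, hg]
        exact f.map_dist d _ _ (i.map_dist d a a' ha)) }
  obtain ⟨h, hh⟩ := hR.2 A B i G (fun φ _ v hv => (hi φ v).2 hv) hBT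
    (Order.lt_succ_of_le hA) (Order.lt_succ_of_le hB)
  choose oA hoA using fun t => hiS ⟨t, o t⟩ (Or.inr ⟨t, rfl⟩)
  obtain ⟨b', hb'⟩ := hjS ⟨s, b⟩ (Or.inl rfl)
  simp only at hoA hb'
  have ho : ∀ t, j.toFun t (G.toFun t (oA t)) = f.toFun t (o t) := fun t =>
    (hg t _).trans (by rw [hoA])
  refine ⟨h.toFun s b', fun d hd => ?_, fun φ hφ x hx hsat => ?_⟩
  · rw [← hb', ← ho] at hd
    have := h.map_dist d _ _ (hj'.dist d _ _ hd)
    rwa [hh, hoA] at this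
  · obtain ⟨xA, hxA⟩ := hiS ⟨s, x⟩ (Or.inl ⟨x, hx, rfl⟩)
    simp only at hxA
    have hxB : j.toFun s (G.toFun s xA) = f.toFun s x := (hg s _).trans (by rw [hxA])
    rw [← hb', ← hxB, ← funext ho, ← j.mapAssignment_pairAssignment (fun t => G.toFun t (oA t)),
      ← hj] at hsat
    have := h.sat_of_isPositive hφ hsat
    rw [h.mapAssignment_pairAssignment, hh, hxA, funext fun t => (hh t _).trans (hoA t)] at this
    exact this

/-- Homomorphisms from an `|L|⁺`-ultrahomogeneous model to atomically closed models are
surjective. -/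
theorem IsUltrahomogeneous.surjective (hT : IsNegativeLocalTheory T)
    (hcomp : IsLocalPositivelyCompact T) {R K : Struct L}
    (hR : IsUltrahomogeneous (Order.succ L.card) T R) (hRT : IsAtomicallyClosed T R)
    (hK : IsAtomicallyClosed T K) (f : Hom R K) (s : L.Srt) :
    Function.Surjective (f.toFun s) := by
  have hκ := L.aleph0_le_card
  by_contra hsurj
  simp only [Function.Surjective, not_forall, not_exists] at hsurj
  obtain ⟨b, hb⟩ := hsurj
  have o : ∀ t, R.carrier t := fun t => (R.nonempty t).some
  choose φ hφ hsat using fun a : R.carrier s =>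
    hK.exists_separates hT (fun t => f.toFun t (o t)) (hb a)
  obtain ⟨d, hd⟩ := hK.1.1.exists_dist b (f.toFun s (o s))
  -- The cardinality condition sits inside the existential so that a total choice function exists;
  -- large sets get the base point as default.
  have hreal : ∀ S : Set (R.carrier s), ∃ a : R.carrier s, #S ≤ L.card → R.dist d a (o s) ∧
      ∀ x ∈ S, R.Sat (Struct.pairAssignment o x a) (φ x) := by
    intro S
    by_cases hS : #S ≤ L.card
    · obtain ⟨a, ha, ha'⟩ := hR.exists_realization hK.1 f o b S hS
      exact ⟨a, fun _ => ⟨ha d hd, fun x hx =>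
        ha' _ (hφ x).isLocalPositive.isPositive x hx (hsat x)⟩⟩
    · exact ⟨o s, fun h => absurd h hS⟩
  choose F hF using hreal
  -- Recursion along the initial ordinal of `|L|⁺`: every proper initial segment has at most `|L|`
  -- elements, so the next element can always be realized over it.
  let J := (Order.succ L.card).ord.ToType
  let a : J → R.carrier s := WellFoundedLT.fix fun i ih => F {x | ∃ j, ∃ h : j < i, ih j h = x}
  have ha : ∀ i, a i = F (a '' Set.Iio i) := by
    intro i
    refine (WellFoundedLT.fix_eq _ i).trans (congrArg F (Set.ext fun x => ?_))
    simp only [Set.mem_ofPred_eq, Set.mem_image, Set.mem_Iio, exists_prop]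
    exact Iff.rfl
  have hJ : #J = Order.succ L.card := mk_ord_toType _
  have hsmall : ∀ i, #(a '' Set.Iio i) ≤ L.card := fun i =>
    mk_image_le.trans (Order.lt_succ_iff.1 ((mk_Iio_lt i (by
      rw [hJ]
      exact (Ordinal.type_toType _).symm)).trans_eq hJ))
  -- The cofinality of the regular cardinal `|L|⁺` exceeds the number of formulas, so one formula
  -- serves `|L|⁺` many indices.
  obtain ⟨ψ, hψ⟩ := infinite_pigeonhole_card (fun i => φ (a i)) (Order.succ L.card) hJ.ge
    (hκ.trans (Order.le_succ _)) (by
      rw [(isRegular_succ hκ).cof_ord]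
      exact Order.lt_succ_of_le L.mk_formula_le_card)
  have hinf : Infinite ((fun i => φ (a i)) ⁻¹' {ψ}) :=
    infinite_iff.2 ((hκ.trans (Order.le_succ _)).trans hψ)
  obtain ⟨i₀⟩ := hinf.nonempty
  have hsep : ψ.Separates T s := (show φ (a i₀) = ψ from i₀.2) ▸ hφ _
  refine hinf.not_finite (hcomp.finite_of_sat hRT.1 o d hsep (fun i => a i.1) (fun i => ?_)
    fun i j hij => ?_)
  · rw [ha]
    exact (hF _ (hsmall i)).1
  · have := (hF _ (hsmall j)).2 (a i) ⟨i, hij, rfl⟩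
    rwa [← ha, show φ (a i) = ψ from i.2] at this

end LocalLogic

theorem mainTheorem7 (L : LocalLogic.LocalLanguage.{u}) (T : Set (LocalLogic.Formula L))
    (hT : LocalLogic.IsNegativeLocalTheory T) (hsat : LocalLogic.IsLocallySatisfiable T)
    (hcomp : LocalLogic.IsLocalPositivelyCompact T) :
    (∀ R : LocalLogic.Struct L, LocalLogic.IsLocalPositivelyClosed T R →
      LocalLogic.IsUltrahomogeneous (Order.succ L.card) T R → LocalLogic.IsRetractor T R) ∧
    LocalLogic.HasRetractors T :=
  ⟨fun _ hR hR' => hR.isAtomicallyClosed.isRetractor hT fun _ hN f =>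
    hR'.surjective hT hcomp hR.isAtomicallyClosed hN f, hcomp.hasRetractors hT⟩
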